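/- Let $1<\alpha\le 2$, $\nu>0$, $c\in\mathbb R$, $L<R$, and let $D^\alpha$ be the left Riemann–Liouville derivative in $x$ with base point $L$ (for $\alpha=2$ the ordinary second derivative). Consider $u_t=c^2D^\alpha u^\nu$, $u\ge 0$, on $[L,R]$ with $u(L,t)=u(R,t)=0$ and a nonnegative bounded initial condition $u_0$, in the form $$(u^\nu)_t=\nu u^{\nu-1}c^2D^\alpha u^\nu .\qquad(*)$$ For $M\ge1$, $k>0$ put $h=(R-L)/M$, $x_j=L+jh$, $t_n=nk$, $\lambda=kc^2/h^\alpha$, $w_i=(-1)^i\binom{\alpha}{i}$. The implicit Euler scheme is, with $\delta_j^{n}=\nu (v_j^{n})^{\nu-1}$ and for $0<j<M$, $$-\lambda\delta_j^{n+1}w_0(v_{j+1}^{n+1})^\nu+(1-\lambda\delta_j^{n+1}w_1)(v_j^{n+1})^\nu-\lambda\delta_j^{n+1}\sum_{i=2}^{j+1}w_i(v_{j+1-i}^{n+1})^\nu=(v_j^n)^\nu,$$ with $v_0^n=v_M^n=0$ and $v_j^0=u_0(x_j)$; for $\nu<1$, $v$ is required to be positive at interior nodes at the levels $t_n>0$,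 so that the weights make sense. Then: **Consistency.** Let $T>0$ and let $u\ge0$ on $[L,R]\times[0,T]$ satisfy $u(L,t)=u(R,t)=0$, with $u^\nu\in C^3([L,R]\times[0,T])$ and, if $\nu<1$, $u>0$ on $(L,R)\times(0,T]$. The local truncation error $\tau_j^{n+1}$ is the difference (left side minus right side) of the scheme for the values of $u$, divided by $k$, minus the residual $(u^\nu)_t-\nu u^{\nu-1}c^2D^\alpha u^\nu$ of $(*)$ at $(x_j,t_{n+1})$. For every compact $K\subset(L,R)\times(0,T]$ there is a $C$, independent of $h,k,j,n$, with $|\tau_j^{n+1}|\le C(h+k)$ whenever $0<j<M$ and $(x_j,t_{n+1})\in K$. If moreover the extension of $u^\nu$ by $0$ to $x<L$ is of class $C^3$ on $(-\infty,R]\times[0,T]$, then there is a $C$, independent of $h,k,j,n$, with $|\tau_j^{n+1}|\le C(\delta_j^{n+1}h+k)$ for all $0<j<M$ and $t_{n+1}\le T$, where $\delta_j^{n+1}=\nu u(x_j,t_{n+1})^{\nu-1}$. **Unconditional stability.** There is no restriction on $h$ and $k$ in the following. Let $A=A(V)$ be the $(M+1)\times(M+1)$ matrix of one step of the scheme with the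 weights $\delta_j=\nu V_j^{\nu-1}$, where $V\ge0$ is any grid function and $0^{\nu-1}$ is read as $0$ if $\nu<1$: its rows $0$ and $M$ are those of the identity, and for $0<i<M$, $A_{ij}=[i=j]-\lambda\delta_iw_{i+1-j}$ for $j\le i+1$ and $A_{ij}=0$ for $j>i+1$. (i) $A$ is strictly diagonally dominant by rows and invertible, every complex eigenvalue $\mu$ of $A$ satisfies $\operatorname{Re}\mu\ge1$ (so every real eigenvalue is $\ge1$), and every complex eigenvalue of $A^{-1}$ has modulus $\le1$. (ii) If $v\ge 0$ solves the scheme for $0\le n\le N$ and $0\le u_0\le B$ on $[L,R]$, then $A(v^{n+1})(v^{n+1})^\nu=(v^n)^\nu$ for $n<N$, and $v_j^n\le B$ for all $j\le M$, $n\le N$. (iii) Errors are not amplified by the linear systems: for any nonnegative grid functions $v^0,\dots,v^N$, if $A(v^{n+1})y^{n+1}=y^n$ and $A(v^{n+1})z^{n+1}=z^n$ for $0\le n<N$, then $\max_j|y_j^n-z_j^n|\le\max_j|y_j^0-z_j^0|$ for all $n\le N$. -/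

import Mathlib

open Set

namespace FracDiff

noncomputable section

/-- The Grünwald weights `w_i = (-1)^i * binom(α, i)`. -/
def grunwaldWeight (α : ℝ) (i : ℕ) : ℝ := (-1) ^ i * Ring.choose α i

/-- The left Riemann-Liouville derivative of order `α` with base point `a`.  The number of
outer derivatives is `n = ⌊α⌋ + 1`; it is `2` for `1 < α < 2`, and for an integer `α` this
convention gives the ordinary `α`-th derivative. -/
def rlDeriv (α a : ℝ) (f : ℝ → ℝ) (x : ℝ) : ℝ :=
  1 / Real.Gamma (((⌊α⌋₊ + 1 : ℕ) : ℝ) - α) *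
    iteratedDeriv (⌊α⌋₊ + 1)
      (fun y => ∫ η in a..y, f η / (y - η) ^ (α + 1 - ((⌊α⌋₊ + 1 : ℕ) : ℝ))) x

/-- The weight `ν * v^(ν - 1)` attached to a node value `v`. -/
def nodeWeight (ν v : ℝ) : ℝ := ν * v ^ (ν - 1)

/-- The space step `h = (R - L) / M`. -/
def spaceStep (L R : ℝ) (M : ℕ) : ℝ := (R - L) / M

/-- The grid point `x_j = L + j h`. -/
def node (L R : ℝ) (M j : ℕ) : ℝ := L + j * spaceStep L R M

/-- The mesh ratio `lam = k c² / h^α`. -/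
def meshRatio (α c L R : ℝ) (M : ℕ) (k : ℝ) : ℝ := k * c ^ 2 / spaceStep L R M ^ α

/-- The left-hand side of the implicit Euler scheme at the interior node `j`, where `V` is the
grid function at the new time level:
`-lam δ_j w_0 V_{j+1}^ν + (1 - lam δ_j w_1) V_j^ν - lam δ_j ∑_{i=2}^{j+1} w_i V_{j+1-i}^ν`,
with `δ_j = ν V_j^(ν-1)`. -/
def schemeLHS (α ν lam : ℝ) (V : ℕ → ℝ) (j : ℕ) : ℝ :=
  -lam * nodeWeight ν (V j) * grunwaldWeight α 0 * V (j + 1) ^ ν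
    + (1 - lam * nodeWeight ν (V j) * grunwaldWeight α 1) * V j ^ ν
    - lam * nodeWeight ν (V j) *
      ∑ i ∈ Finset.Icc 2 (j + 1), grunwaldWeight α i * V (j + 1 - i) ^ ν

/-- `v n j`, for `n ≤ N` and `j ≤ M`, is a nonnegative grid solution of the implicit Euler scheme
with initial values `u₀` and homogeneous Dirichlet boundary values.  For `ν < 1` the weights
`ν v^(ν-1)` only make sense at nodes where `v` is positive. -/
structure IsSchemeSolution (α ν c L R : ℝ) (u₀ : ℝ → ℝ) (M N : ℕ) (k : ℝ)
    (v : ℕ → ℕ → ℝ) : Prop where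
  nonneg : ∀ n ≤ N, ∀ j ≤ M, 0 ≤ v n j
  pos : ν < 1 → ∀ n < N, ∀ j, 0 < j → j < M → 0 < v (n + 1) j
  init : ∀ j, 0 < j → j < M → v 0 j = u₀ (node L R M j)
  left : ∀ n ≤ N, v n 0 = 0
  right : ∀ n ≤ N, v n M = 0
  step : ∀ n < N, ∀ j, 0 < j → j < M →
    schemeLHS α ν (meshRatio α c L R M k) (v (n + 1)) j = v n j ^ ν

/-- The `(M+1) × (M+1)` matrix of the linear system of one time step with weights `d`: the rows
`0` and `M` are those of the identity, and an interior row `i` has the entries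
`1 - lam d_i w_1` on the diagonal, and `-lam d_i w_{i+1-j}` for the other `j ≤ i + 1`. -/
def systemMatrix (α lam : ℝ) (M : ℕ) (d : ℕ → ℝ) : Matrix (Fin (M + 1)) (Fin (M + 1)) ℝ :=
  Matrix.of fun i j =>
    if (i : ℕ) = 0 ∨ (i : ℕ) = M then (if i = j then 1 else 0)
    else (if i = j then 1 else 0) -
      (if (j : ℕ) ≤ i + 1 then lam * d i * grunwaldWeight α (i + 1 - j) else 0)

/-- The system matrix whose weights are those of the grid function `V` at the new time level. -/
def schemeMatrix (α ν c L R : ℝ) (M : ℕ) (k : ℝ) (V : ℕ → ℝ) :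
    Matrix (Fin (M + 1)) (Fin (M + 1)) ℝ :=
  systemMatrix α (meshRatio α c L R M k) M (fun j => nodeWeight ν (V j))

/-- The vector `(V_0^ν, …, V_M^ν)`. -/
def powVec (ν : ℝ) (M : ℕ) (V : ℕ → ℝ) : Fin (M + 1) → ℝ := fun j => V j ^ ν

/-- Strict diagonal dominance by rows. -/
def StrictlyRowDiagDominant {m : ℕ} (A : Matrix (Fin m) (Fin m) ℝ) : Prop :=
  ∀ i, ∑ j ∈ Finset.univ.erase i, |A i j| < |A i i|

/-- `μ` is a complex eigenvalue of the real matrix `A`. -/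
def IsComplexEigenvalue {m : ℕ} (A : Matrix (Fin m) (Fin m) ℝ) (μ : ℂ) : Prop :=
  Module.End.HasEigenvalue (Matrix.toLin' (A.map Complex.ofReal)) μ

/-- Unconditional stability: no relation between the steps `k > 0` and `h = (R - L) / M` is
assumed.  Norms of vectors are maximum norms. -/
def UnconditionallyStable (α ν c L R : ℝ) : Prop :=
  ∀ (M N : ℕ) (k : ℝ), 0 < M → 0 < k →
    -- a solution of the scheme solves the linear systems, and it is bounded by its initial data
    (∀ (u₀ : ℝ → ℝ) (B : ℝ), (∀ x ∈ Icc L R, 0 ≤ u₀ x ∧ u₀ x ≤ B) →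
      ∀ v : ℕ → ℕ → ℝ, IsSchemeSolution α ν c L R u₀ M N k v →
        (∀ n < N, (schemeMatrix α ν c L R M k (v (n + 1))).mulVec (powVec ν M (v (n + 1)))
          = powVec ν M (v n)) ∧
        (∀ n ≤ N, ∀ j ≤ M, v n j ≤ B)) ∧
    -- the matrix of one step
    (∀ V : ℕ → ℝ, (∀ j ≤ M, 0 ≤ V j) →
      StrictlyRowDiagDominant (schemeMatrix α ν c L R M k V) ∧
      IsUnit (schemeMatrix α ν c L R M k V) ∧
      (∀ μ : ℂ, IsComplexEigenvalue (schemeMatrix α ν c L R M k V) μ → 1 ≤ μ.re) ∧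
      (∀ μ : ℂ, IsComplexEigenvalue (schemeMatrix α ν c L R M k V)⁻¹ μ → ‖μ‖ ≤ 1)) ∧
    -- an error in the initial data is not amplified by the linear systems
    (∀ v : ℕ → ℕ → ℝ, (∀ n ≤ N, ∀ j ≤ M, 0 ≤ v n j) → ∀ y z : ℕ → Fin (M + 1) → ℝ,
      (∀ n < N, (schemeMatrix α ν c L R M k (v (n + 1))).mulVec (y (n + 1)) = y n) →
      (∀ n < N, (schemeMatrix α ν c L R M k (v (n + 1))).mulVec (z (n + 1)) = z n) →
      ∀ n ≤ N, ‖y n - z n‖ ≤ ‖y 0 - z 0‖)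

/-- The functions on which consistency is tested: `u ≥ 0` on `[L,R] × [0,T]`, with homogeneous
Dirichlet boundary values, `u^ν` of class `C³`, and, if `ν < 1`, with `u` positive at the interior
points, where otherwise `u^(ν-1)` is undefined. -/
structure IsTestProfile (ν L R T : ℝ) (u : ℝ → ℝ → ℝ) : Prop where
  nonneg : ∀ x ∈ Icc L R, ∀ t ∈ Icc 0 T, 0 ≤ u x t
  left : ∀ t ∈ Icc 0 T, u L t = 0
  right : ∀ t ∈ Icc 0 T, u R t = 0
  pos : ν < 1 → ∀ x ∈ Ioo L R, ∀ t ∈ Ioc 0 T, 0 < u x t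
  smooth : ContDiffOn ℝ 3 (fun p : ℝ × ℝ => u p.1 p.2 ^ ν) (Icc L R ×ˢ Icc 0 T)

/-- The residual `(u^ν)_t - ν u^(ν-1) c² D^α u^ν` of the differential equation at `(x, t)`, with
the time derivative taken within `[0,T]`. -/
def pdeResidual (α ν c L T : ℝ) (u : ℝ → ℝ → ℝ) (x t : ℝ) : ℝ :=
  derivWithin (fun s => u x s ^ ν) (Icc 0 T) t
    - nodeWeight ν (u x t) * c ^ 2 * rlDeriv α L (fun y => u y t ^ ν) x

/-- The residual of the scheme, divided by the time step, for the values of `u` at the nodes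
of the grid `x_j`, `t_n = n k`. -/
def schemeResidual (α ν c L R : ℝ) (u : ℝ → ℝ → ℝ) (M : ℕ) (k : ℝ) (j n : ℕ) : ℝ :=
  (schemeLHS α ν (meshRatio α c L R M k) (fun i => u (node L R M i) ((n + 1 : ℕ) * k)) j
    - u (node L R M j) (n * k) ^ ν) / k

/-- The local truncation error at `(x_j, t_{n+1})`. -/
def truncationError (α ν c L R T : ℝ) (u : ℝ → ℝ → ℝ) (M : ℕ) (k : ℝ) (j n : ℕ) : ℝ :=
  schemeResidual α ν c L R u M k j n
    - pdeResidual α ν c L T u (node L R M j) ((n + 1 : ℕ) * k)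

/-- Consistency of order `O(h) + O(k)`. The truncation error of every test profile is at most
`C (h + k)` on each compact part of `(L,R) × (0,T]`; if in addition the extension of `u^ν` by zero
to `x < L` is of class `C³`, then it is at most `C (δ_j^{n+1} h + k)` at all interior nodes. -/
def ConsistentFirstOrder (α ν c L R : ℝ) : Prop :=
  ∀ (T : ℝ), 0 < T → ∀ u : ℝ → ℝ → ℝ, IsTestProfile ν L R T u →
    (∀ K : Set (ℝ × ℝ), IsCompact K → K ⊆ Ioo L R ×ˢ Ioc 0 T →
      ∃ C : ℝ, ∀ (M : ℕ) (k : ℝ), 0 < M → 0 < k → ∀ j n : ℕ, 0 < j → j < M →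
        (node L R M j, ((n + 1 : ℕ) : ℝ) * k) ∈ K →
        |truncationError α ν c L R T u M k j n| ≤ C * (spaceStep L R M + k)) ∧
    (ContDiffOn ℝ 3 (fun p : ℝ × ℝ => if L ≤ p.1 then u p.1 p.2 ^ ν else 0)
        (Iic R ×ˢ Icc 0 T) →
      ∃ C : ℝ, ∀ (M : ℕ) (k : ℝ), 0 < M → 0 < k → ∀ j n : ℕ, 0 < j → j < M →
        ((n + 1 : ℕ) : ℝ) * k ≤ T →
        |truncationError α ν c L R T u M k j n| ≤
          C * (nodeWeight ν (u (node L R M j) ((n + 1 : ℕ) * k)) * spaceStep L R M + k))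

end

end FracDiff

namespace FracDiff

/-! ### Grünwald weights: recurrences, signs, partial sums, asymptotics. -/

section Weights

/-! Everything rests on the generating function `(1 - z)^α = ∑ w_i z^i`.

Stability. For `1 < α ≤ 2` only `w_1 = -α` is negative, and the partial sums of the weights from
index 1 on are `≤ 0`. So the other weights in a row add up to at most `α` (`sum_grunwaldWeight_le`),
and each diagonal entry of the step matrix exceeds the absolute sum of the rest of its row by at
least 1 (`sum_systemMatrix_row_le`). This gives `‖y‖ ≤ ‖A y‖` in the maximum norm, whence the bounds
on solutions and errors; Gershgorin's theorem places the spectrum in `Re μ ≥ 1`.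

Consistency. Put `β = 2 - α`. Factoring `(1 - z)^α = (1 - z)^2 (1 - z)^(-β)` turns the Grünwald sum
into a convolution of second differences with the weights of order `-β`, plus a boundary term
(`sum_grunwaldWeight_mul`). For `β > 0` these weights discretize the fractional integral of order
`β`: by Gautschi's inequality their partial sums are `n^β / Γ(β+1) + O(n^(β-1))`, and `n^β / Γ(β+1)`
belongs to the product-rectangle rule. Summation by parts against the Lipschitz function `f''`
compares the two. Integration by parts brings the Riemann–Liouville derivative to the matching form
(`Gamma_mul_rlDeriv`). The error is `O(h)` times powers of the distance `x - L`; the negative powers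
carry the factors `f'(L)` and `f''(L)`. They are bounded on compact sets, and absent when the
extension by zero is `C³`. -/

@[simp] lemma grunwaldWeight_zero (α : ℝ) : grunwaldWeight α 0 = 1 := by
  simp [grunwaldWeight]

@[simp] lemma grunwaldWeight_one (α : ℝ) : grunwaldWeight α 1 = -α := by
  simp [grunwaldWeight]

lemma grunwaldWeight_succ_eq_sub (α : ℝ) (i : ℕ) :
    grunwaldWeight α (i + 1) = grunwaldWeight (α - 1) (i + 1) - grunwaldWeight (α - 1) i := by
  have h := Ring.choose_succ_succ (α - 1) i
  rw [sub_add_cancel] at h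
  rw [grunwaldWeight, grunwaldWeight, grunwaldWeight, h]
  ring

lemma grunwaldWeight_add_two (α : ℝ) (i : ℕ) :
    grunwaldWeight α (i + 2) = grunwaldWeight (α - 2) (i + 2) - 2 * grunwaldWeight (α - 2) (i + 1)
      + grunwaldWeight (α - 2) i := by
  have h := grunwaldWeight_succ_eq_sub α (i + 1)
  rw [grunwaldWeight_succ_eq_sub (α - 1) (i + 1), grunwaldWeight_succ_eq_sub (α - 1) i,
    show α - 1 - 1 = α - 2 by ring] at h
  rw [h]
  ring

lemma succ_mul_grunwaldWeight (α : ℝ) (i : ℕ) :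
    ((i : ℝ) + 1) * grunwaldWeight α (i + 1) = (i - α) * grunwaldWeight α i := by
  have h0 := Ring.descPochhammer_eq_factorial_smul_choose α i
  have h1 := Ring.descPochhammer_eq_factorial_smul_choose α (i + 1)
  rw [descPochhammer_succ_right, Polynomial.smeval_mul, h0] at h1
  simp only [Polynomial.smeval_sub, Polynomial.smeval_X, pow_one, Polynomial.smeval_natCast,
    pow_zero, nsmul_eq_mul, mul_one, Nat.factorial_succ, Nat.cast_mul] at h1
  have hf : ((i.factorial : ℕ) : ℝ) ≠ 0 := by positivity
  have h2 : Ring.choose α i * (α - i) = (i + 1) * Ring.choose α (i + 1) := by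
    apply mul_left_cancel₀ hf
    push_cast at h1
    linear_combination h1
  rw [grunwaldWeight, grunwaldWeight]
  linear_combination (-1) ^ i * h2

/-- Summing coefficients is division by `1 - z`, which lowers the order by one. -/
lemma sum_range_grunwaldWeight (α : ℝ) (n : ℕ) :
    ∑ i ∈ Finset.range (n + 1), grunwaldWeight α i = grunwaldWeight (α - 1) n := by
  induction n with
  | zero => simp
  | succ n ih => rw [Finset.sum_range_succ, ih, grunwaldWeight_succ_eq_sub]; ring

lemma grunwaldWeight_nonneg {α : ℝ} (h1 : 1 < α) (h2 : α ≤ 2) {i : ℕ} (hi : 2 ≤ i) :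
    0 ≤ grunwaldWeight α i := by
  induction i, hi using Nat.le_induction with
  | base =>
    have h := succ_mul_grunwaldWeight α 1
    norm_num at h
    nlinarith
  | succ n hn ih =>
    have hn' : (2 : ℝ) ≤ n := by exact_mod_cast hn
    have h := succ_mul_grunwaldWeight α n
    have : 0 ≤ ((n : ℝ) + 1) * grunwaldWeight α (n + 1) := by
      rw [h]; exact mul_nonneg (by linarith) ih
    exact nonneg_of_mul_nonneg_right this (by positivity)

lemma grunwaldWeight_nonpos {γ : ℝ} (h0 : 0 ≤ γ) (h1 : γ ≤ 1) {i : ℕ} (hi : 1 ≤ i) :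
    grunwaldWeight γ i ≤ 0 := by
  induction i, hi using Nat.le_induction with
  | base => simpa using h0
  | succ n hn ih =>
    have hn' : (1 : ℝ) ≤ n := by exact_mod_cast hn
    have h := succ_mul_grunwaldWeight γ n
    have : ((n : ℝ) + 1) * grunwaldWeight γ (n + 1) ≤ 0 := by
      rw [h]; exact mul_nonpos_of_nonneg_of_nonpos (by linarith) ih
    exact nonpos_of_mul_nonpos_right this (by positivity)

lemma grunwaldWeight_neg_nonneg {β : ℝ} (h : 0 ≤ β) (i : ℕ) : 0 ≤ grunwaldWeight (-β) i := by
  induction i with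
  | zero => simp
  | succ n ih =>
    have h := succ_mul_grunwaldWeight (-β) n
    have : 0 ≤ ((n : ℝ) + 1) * grunwaldWeight (-β) (n + 1) := by
      rw [h]; exact mul_nonneg (by rw [sub_neg_eq_add]; positivity) ih
    exact nonneg_of_mul_nonneg_right this (by positivity)

/-- The sum of the absolute values of the weights other than `w_1` is at most `α`. -/
lemma sum_grunwaldWeight_le {α : ℝ} (h1 : 1 < α) (h2 : α ≤ 2) {n : ℕ} (hn : 1 ≤ n) :
    ∑ i ∈ (Finset.range (n + 1)).erase 1, |grunwaldWeight α i| ≤ α := by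
  have hsum := sum_range_grunwaldWeight α n
  -- This is the full partial sum, `w_1 = -α` included; its sign is what bounds the remaining
  -- weights by `α`.
  have hneg : grunwaldWeight (α - 1) n ≤ 0 :=
    grunwaldWeight_nonpos (by linarith) (by linarith) hn
  have hmem : 1 ∈ Finset.range (n + 1) := Finset.mem_range.2 (by omega)
  rw [← Finset.add_sum_erase _ _ hmem, grunwaldWeight_one] at hsum
  have : ∑ i ∈ (Finset.range (n + 1)).erase 1, |grunwaldWeight α i|
      = ∑ i ∈ (Finset.range (n + 1)).erase 1, grunwaldWeight α i := by
    refine Finset.sum_congr rfl fun i hi => abs_of_nonneg ?_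
    rcases Nat.eq_zero_or_pos i with rfl | hpos
    · simp
    · exact grunwaldWeight_nonneg h1 h2
        (by have := Finset.ne_of_mem_erase hi; omega)
  linarith

/-- Both sides satisfy the same first-order recurrence in `n`. The closed form makes Gamma-ratio
estimates applicable to the weights. -/
lemma grunwaldWeight_neg_mul_Gamma {β : ℝ} (hβ : 0 < β) (n : ℕ) :
    grunwaldWeight (-β) n * (Real.Gamma β * n.factorial) = Real.Gamma (n + β) := by
  induction n with
  | zero => simp
  | succ n ih =>
    have h := succ_mul_grunwaldWeight (-β) n
    have hg := Real.Gamma_add_one (s := n + β) (by positivity)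
    rw [Nat.factorial_succ]
    push_cast
    rw [show (n : ℝ) + 1 + β = n + β + 1 by ring, hg, ← ih]
    linear_combination Real.Gamma β * n.factorial * h

/-- Gautschi's inequality, in the form of a first order asymptotic expansion. -/
lemma abs_Gamma_ratio_sub_rpow_le {β : ℝ} (h0 : 0 < β) (h1 : β < 1) {n : ℕ} (hn : 1 ≤ n) :
    |Real.Gamma (n + β) / Real.Gamma n - (n : ℝ) ^ β| ≤ (n : ℝ) ^ (β - 1) := by
  have hn1 : (1 : ℝ) ≤ n := by exact_mod_cast hn
  have hn0 : (0 : ℝ) < n := by linarith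
  have hG : 0 < Real.Gamma n := Real.Gamma_pos_of_pos hn0
  have hGβ : 0 < Real.Gamma (n + β) := Real.Gamma_pos_of_pos (by positivity)
  have upper : Real.Gamma (n + β) ≤ (n : ℝ) ^ β * Real.Gamma n := by
    have h := Real.Gamma_mul_add_mul_le_rpow_Gamma_mul_rpow_Gamma hn0
      (by positivity : (0 : ℝ) < n + 1) (by linarith : 0 < 1 - β) h0 (by ring)
    rw [show (1 - β) * (n : ℝ) + β * (n + 1) = n + β by ring, Real.Gamma_add_one hn0.ne',
      Real.mul_rpow hn0.le hG.le] at h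
    have e : Real.Gamma n ^ (1 - β) * Real.Gamma n ^ β = Real.Gamma n := by
      rw [← Real.rpow_add hG]; simp
    calc _ ≤ _ := h
      _ = (n : ℝ) ^ β * (Real.Gamma n ^ (1 - β) * Real.Gamma n ^ β) := by ring
      _ = _ := by rw [e]
  -- Log-convexity again, now with `n + 1` as the convex combination of `n + β` and `n + β + 1`.
  have lower : n * Real.Gamma n ≤ Real.Gamma (n + β) * ((n : ℝ) + β) ^ (1 - β) := by
    have hp : (0 : ℝ) < n + β := by positivity
    have h := Real.Gamma_mul_add_mul_le_rpow_Gamma_mul_rpow_Gamma hp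
      (by positivity : (0 : ℝ) < n + β + 1) h0 (by linarith : 0 < 1 - β) (by ring)
    rw [show β * ((n : ℝ) + β) + (1 - β) * (n + β + 1) = n + 1 by ring, Real.Gamma_add_one hn0.ne',
      Real.Gamma_add_one hp.ne', Real.mul_rpow hp.le hGβ.le] at h
    have e : Real.Gamma (n + β) ^ β * Real.Gamma (n + β) ^ (1 - β) = Real.Gamma (n + β) := by
      rw [← Real.rpow_add hGβ]; simp
    calc _ ≤ _ := h
      _ = (Real.Gamma (n + β) ^ β * Real.Gamma (n + β) ^ (1 - β)) * ((n : ℝ) + β) ^ (1 - β) := by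
        ring
      _ = _ := by rw [e]
  have bern : ((n : ℝ) + β) ^ (1 - β) ≤ (n : ℝ) ^ (1 - β) * (1 + 1 / n) := by
    have hb := rpow_one_add_le_one_add_mul_self (s := β / n)
      (by have : 0 ≤ β / (n : ℝ) := by positivity
          linarith) (by linarith : 0 ≤ 1 - β) (by linarith)
    rw [show (n : ℝ) + β = n * (1 + β / n) by field_simp, Real.mul_rpow hn0.le (by positivity)]
    refine mul_le_mul_of_nonneg_left (hb.trans ?_) (by positivity)
    have : (1 - β) * (β / n) ≤ 1 / n := by
      rw [← mul_div_assoc]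
      gcongr
      nlinarith
    linarith
  have e1 : (n : ℝ) ^ (β - 1) = (n : ℝ) ^ β / n := Real.rpow_sub_one hn0.ne' β
  have e2 : (n : ℝ) ^ (1 - β) * (n : ℝ) ^ β = n := by
    rw [← Real.rpow_add hn0]; simp
  have hpβ : 0 < (n : ℝ) ^ β := by positivity
  have hr : Real.Gamma (n + β) / Real.Gamma n ≤ (n : ℝ) ^ β := by
    rwa [div_le_iff₀ hG]
  rw [abs_sub_comm, abs_of_nonneg (by linarith), e1]
  set r := Real.Gamma (n + β) / Real.Gamma n with hrdef
  have hr' : r * Real.Gamma n = Real.Gamma (n + β) := by rw [hrdef]; field_simp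
  have hr0 : 0 < r := by positivity
  have key : (n : ℝ) ≤ r * ((n : ℝ) ^ (1 - β) * (1 + 1 / n)) := by
    have : n * Real.Gamma n ≤ (r * ((n : ℝ) ^ (1 - β) * (1 + 1 / n))) * Real.Gamma n := by
      calc _ ≤ _ := lower
        _ ≤ Real.Gamma (n + β) * ((n : ℝ) ^ (1 - β) * (1 + 1 / n)) := by gcongr
        _ = _ := by rw [← hr']; ring
    exact le_of_mul_le_mul_right this hG
  have key2 : (n : ℝ) ^ β ≤ r * (1 + 1 / n) := by
    have h3 := mul_le_mul_of_nonneg_right key hpβ.le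
    have : n * (n : ℝ) ^ β ≤ n * (r * (1 + 1 / n)) := by
      calc _ ≤ _ := h3
        _ = ((n : ℝ) ^ (1 - β) * (n : ℝ) ^ β) * (r * (1 + 1 / n)) := by ring
        _ = _ := by rw [e2]
    exact le_of_mul_le_mul_left this hn0
  have : r * (1 / n) ≤ (n : ℝ) ^ β / n := by
    rw [mul_one_div]; gcongr
  linarith

/-- The partial sum is a single weight of order `-(β + 1)`, hence exactly `Γ(n+β) / (Γ(n) Γ(β+1))`,
and Gautschi applies. -/
lemma abs_sum_grunwaldWeight_sub_le {β : ℝ} (h0 : 0 < β) (h1 : β < 1) {n : ℕ} (hn : 1 ≤ n) :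
    |∑ i ∈ Finset.range n, grunwaldWeight (-β) i - (n : ℝ) ^ β / Real.Gamma (β + 1)|
      ≤ (n : ℝ) ^ (β - 1) / Real.Gamma (β + 1) := by
  obtain ⟨m, rfl⟩ := Nat.exists_eq_add_of_le' hn
  have hG : 0 < Real.Gamma (β + 1) := Real.Gamma_pos_of_pos (by linarith)
  have h := grunwaldWeight_neg_mul_Gamma (by linarith : 0 < β + 1) m
  have hb := abs_Gamma_ratio_sub_rpow_le h0 h1 hn
  have e : ∑ i ∈ Finset.range (m + 1), grunwaldWeight (-β) i
      = Real.Gamma ((m + 1 : ℕ) + β) / Real.Gamma (m + 1 : ℕ) / Real.Gamma (β + 1) := by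
    rw [sum_range_grunwaldWeight, show -β - 1 = -(β + 1) by ring]
    push_cast
    rw [Real.Gamma_nat_eq_factorial, show (m : ℝ) + 1 + β = m + (β + 1) by ring, ← h]
    field_simp
  rw [e, ← sub_div, abs_div, abs_of_pos hG]
  gcongr

/-- Lets the estimate of the partial sums also control an individual weight. -/
lemma sum_grunwaldWeight_neg_eq (β : ℝ) (n : ℕ) :
    β * ∑ i ∈ Finset.range n, grunwaldWeight (-β) i = n * grunwaldWeight (-β) n := by
  induction n with
  | zero => simp
  | succ n ih =>
    rw [Finset.sum_range_succ, mul_add, ih]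
    have := succ_mul_grunwaldWeight (-β) n
    push_cast
    linear_combination -this

/-- Convolution form of `(1 - z)^α = (1 - z)^2 (1 - z)^(α-2)`. The two isolated terms are the second
differences at the indices `0` and `-1` of `f` extended by zero. The induction on `n` shifts `f`, so
`f` is quantified inside. -/
lemma sum_grunwaldWeight_mul (α : ℝ) (n : ℕ) : ∀ f : ℕ → ℝ,
    ∑ i ∈ Finset.range (n + 2), grunwaldWeight α i * f (n + 1 - i)
      = ∑ i ∈ Finset.range n,
          grunwaldWeight (α - 2) i * (f (n - i + 1) - 2 * f (n - i) + f (n - i - 1))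
        + grunwaldWeight (α - 2) n * (f 1 - 2 * f 0) + grunwaldWeight (α - 2) (n + 1) * f 0 := by
  induction n with
  | zero =>
    intro f
    simp [Finset.sum_range_succ]
    ring
  | succ n ih =>
    intro f
    have h := ih (fun i => f (i + 1))
    rw [Finset.sum_range_succ]
    have e1 : ∑ i ∈ Finset.range (n + 2), grunwaldWeight α i * f (n + 1 + 1 - i)
        = ∑ i ∈ Finset.range (n + 2), grunwaldWeight α i * f (n + 1 - i + 1) := by
      refine Finset.sum_congr rfl fun i hi => ?_
      rw [show n + 1 + 1 - i = n + 1 - i + 1 by have := Finset.mem_range.1 hi; omega]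
    have e2 : ∑ i ∈ Finset.range n, grunwaldWeight (α - 2) i
          * (f (n + 1 - i + 1) - 2 * f (n + 1 - i) + f (n + 1 - i - 1))
        = ∑ i ∈ Finset.range n, grunwaldWeight (α - 2) i
          * (f (n - i + 1 + 1) - 2 * f (n - i + 1) + f (n - i - 1 + 1)) := by
      refine Finset.sum_congr rfl fun i hi => ?_
      have := Finset.mem_range.1 hi
      rw [show n + 1 - i + 1 = n - i + 1 + 1 by omega, show n + 1 - i = n - i + 1 by omega,
        show n - i + 1 - 1 = n - i - 1 + 1 by omega]
    rw [e1, h, Finset.sum_range_succ _ n, e2, grunwaldWeight_add_two α n]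
    simp
    ring

/-- Telescoping: Bernoulli's inequality gives `β (n+1)^(β-1) ≤ (n+1)^β - n^β`. -/
lemma sum_rpow_sub_one_le {β : ℝ} (h0 : 0 < β) (h1 : β ≤ 1) (n : ℕ) :
    ∑ i ∈ Finset.range n, ((i : ℝ) + 1) ^ (β - 1) ≤ (n : ℝ) ^ β / β := by
  induction n with
  | zero => simp [Real.zero_rpow h0.ne']
  | succ n ih =>
    rw [Finset.sum_range_succ]
    have hn : (0 : ℝ) < n + 1 := by positivity
    have hb := rpow_one_add_le_one_add_mul_self (s := -(1 / ((n : ℝ) + 1)))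
      (by rw [neg_le_neg_iff, div_le_one hn]; linarith [(Nat.cast_nonneg n : (0 : ℝ) ≤ n)]) h0.le h1
    have e : (n : ℝ) ^ β = ((n : ℝ) + 1) ^ β * (1 + -(1 / ((n : ℝ) + 1))) ^ β := by
      rw [← Real.mul_rpow hn.le]
      · congr 1; field_simp; ring
      · have : 1 + -(1 / ((n : ℝ) + 1)) = n / (n + 1) := by field_simp; ring
        rw [this]; positivity
    have h3 : (n : ℝ) ^ β ≤ ((n : ℝ) + 1) ^ β - β * ((n : ℝ) + 1) ^ (β - 1) := by
      rw [e, Real.rpow_sub_one hn.ne']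
      calc _ ≤ ((n : ℝ) + 1) ^ β * (1 + β * -(1 / ((n : ℝ) + 1))) := by gcongr
        _ = _ := by field_simp; ring
    have h4 : (n : ℝ) ^ β / β ≤ ((n : ℝ) + 1) ^ β / β - ((n : ℝ) + 1) ^ (β - 1) := by
      rw [le_sub_iff_add_le, ← sub_nonneg]
      have : ((n : ℝ) + 1) ^ β / β - ((n : ℝ) ^ β / β + ((n : ℝ) + 1) ^ (β - 1))
        = (((n : ℝ) + 1) ^ β - β * ((n : ℝ) + 1) ^ (β - 1) - (n : ℝ) ^ β) / β := by
        field_simp; ring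
      rw [this]
      exact div_nonneg (by linarith) h0.le
    push_cast
    linarith

end Weights

end FracDiff

namespace FracDiff

/-! ### Unconditional stability from diagonal dominance with margin 1. -/

section Stability

/-- In the row where `|y i|` is maximal, the diagonal term outweighs all the others by at least
`‖y‖`. -/
lemma norm_le_norm_mulVec {m : ℕ} (A : Matrix (Fin m) (Fin m) ℝ)
    (hA : ∀ i, 1 + ∑ j ∈ Finset.univ.erase i, |A i j| ≤ A i i) (y : Fin m → ℝ) :
    ‖y‖ ≤ ‖A.mulVec y‖ := by
  rcases isEmpty_or_nonempty (Fin m) with h | h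
  · exact le_of_eq (congrArg norm (Subsingleton.elim y (A.mulVec y)))
  obtain ⟨i, -, himax⟩ := Finset.exists_max_image Finset.univ (fun i => ‖y i‖) Finset.univ_nonempty
  have hi : ‖y i‖ = ‖y‖ := le_antisymm (norm_le_pi_norm y i)
    ((pi_norm_le_iff_of_nonneg (norm_nonneg _)).2 fun j => himax j (Finset.mem_univ j))
  refine le_trans ?_ (norm_le_pi_norm (A.mulVec y) i)
  have hy : ∀ j, |y j| ≤ ‖y‖ := fun j => norm_le_pi_norm y j
  have hi' : |y i| = ‖y‖ := hi
  have e : A.mulVec y i = A i i * y i + ∑ j ∈ Finset.univ.erase i, A i j * y j := by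
    rw [Matrix.mulVec, dotProduct, ← Finset.add_sum_erase _ _ (Finset.mem_univ i)]
  have hs : |∑ j ∈ Finset.univ.erase i, A i j * y j|
      ≤ (∑ j ∈ Finset.univ.erase i, |A i j|) * ‖y‖ := by
    rw [Finset.sum_mul]
    refine (Finset.abs_sum_le_sum_abs _ _).trans (Finset.sum_le_sum fun j _ => ?_)
    rw [abs_mul]
    exact mul_le_mul_of_nonneg_left (hy j) (abs_nonneg _)
  have hpos : 0 ≤ A i i := by
    have := Finset.sum_nonneg (s := Finset.univ.erase i) fun j _ => abs_nonneg (A i j)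
    linarith [hA i]
  have h3 : A i i * ‖y‖ = |A i i * y i| := by rw [abs_mul, abs_of_nonneg hpos, hi']
  have h4 := mul_le_mul_of_nonneg_right (hA i) (norm_nonneg y)
  have h5 : |A i i * y i| ≤ |A.mulVec y i| + |∑ j ∈ Finset.univ.erase i, A i j * y j| := by
    rw [e]
    calc |A i i * y i| = |(A i i * y i + ∑ j ∈ Finset.univ.erase i, A i j * y j)
          - ∑ j ∈ Finset.univ.erase i, A i j * y j| := by ring_nf
      _ ≤ _ := abs_sub _ _
  rw [Real.norm_eq_abs]
  linarith

/-- Each Gershgorin disc has real centre `A i i` and radius at most `A i i - 1`. -/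
lemma one_le_re_of_isComplexEigenvalue {m : ℕ} {A : Matrix (Fin m) (Fin m) ℝ}
    (hA : ∀ i, 1 + ∑ j ∈ Finset.univ.erase i, |A i j| ≤ A i i) {μ : ℂ}
    (hμ : IsComplexEigenvalue A μ) : 1 ≤ μ.re := by
  obtain ⟨i, hi⟩ := eigenvalue_mem_ball hμ
  rw [mem_closedBall_iff_norm] at hi
  simp only [Matrix.map_apply, Complex.norm_real, Real.norm_eq_abs] at hi
  have h1 := (Complex.abs_re_le_norm _).trans hi
  rw [Complex.sub_re, Complex.ofReal_re] at h1
  linarith [hA i, (abs_le.1 h1).1]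

lemma IsComplexEigenvalue.inv {m : ℕ} {A : Matrix (Fin m) (Fin m) ℝ} (hA : IsUnit A) {μ : ℂ}
    (hμ : IsComplexEigenvalue A⁻¹ μ) : μ ≠ 0 ∧ IsComplexEigenvalue A μ⁻¹ := by
  obtain ⟨v, hv, hv0⟩ := hμ.exists_hasEigenvector
  rw [Module.End.mem_eigenspace_iff, Matrix.toLin'_apply] at hv
  have hdet := (Matrix.isUnit_iff_isUnit_det A).1 hA
  have e : (A.map Complex.ofReal) * (A⁻¹.map Complex.ofReal) = 1 := by
    have := congrArg (fun B : Matrix (Fin m) (Fin m) ℝ => B.map Complex.ofRealHom)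
      (Matrix.mul_nonsing_inv A hdet)
    simp only [Matrix.map_mul] at this
    rw [Matrix.map_one _ (map_zero _) (map_one _)] at this
    exact this
  have h1 : v = μ • (A.map Complex.ofReal).mulVec v := by
    rw [← Matrix.mulVec_smul, ← hv, Matrix.mulVec_mulVec, e, Matrix.one_mulVec]
  have hμ0 : μ ≠ 0 := by
    rintro rfl
    exact hv0 (by rw [h1, zero_smul])
  refine ⟨hμ0, Module.End.hasEigenvalue_of_hasEigenvector (x := v) ⟨?_, hv0⟩⟩
  rw [Module.End.mem_eigenspace_iff, Matrix.toLin'_apply]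
  nth_rewrite 2 [h1]
  rw [smul_smul, inv_mul_cancel₀ hμ0, one_smul]

lemma systemMatrix_boundary (α lam : ℝ) {M : ℕ} (d : ℕ → ℝ) {i : Fin (M + 1)}
    (hi : (i : ℕ) = 0 ∨ (i : ℕ) = M) (j : Fin (M + 1)) :
    systemMatrix α lam M d i j = if i = j then 1 else 0 := by
  rw [systemMatrix, Matrix.of_apply, if_pos hi]

lemma systemMatrix_interior (α lam : ℝ) {M : ℕ} (d : ℕ → ℝ) {i : Fin (M + 1)}
    (hi : ¬ ((i : ℕ) = 0 ∨ (i : ℕ) = M)) (j : Fin (M + 1)) :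
    systemMatrix α lam M d i j = (if i = j then 1 else 0) -
      (if (j : ℕ) ≤ i + 1 then lam * d i * grunwaldWeight α (i + 1 - j) else 0) := by
  rw [systemMatrix, Matrix.of_apply, if_neg hi]

/-- The off-diagonal entries of an interior row are `-lam d_i` times distinct weights of index other
than 1, whose absolute sum is at most `α`, while the diagonal entry is `1 + lam d_i α`. Boundary
rows attain equality. -/
lemma sum_systemMatrix_row_le {α lam : ℝ} (hα₁ : 1 < α) (hα₂ : α ≤ 2) (hlam : 0 ≤ lam) {M : ℕ}
    {d : ℕ → ℝ} (hd : ∀ j ≤ M, 0 ≤ d j) (i : Fin (M + 1)) :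
    1 + ∑ j ∈ Finset.univ.erase i, |systemMatrix α lam M d i j| ≤ systemMatrix α lam M d i i := by
  by_cases hi : (i : ℕ) = 0 ∨ (i : ℕ) = M
  · have : ∑ j ∈ Finset.univ.erase i, |systemMatrix α lam M d i j| = 0 := by
      refine Finset.sum_eq_zero fun j hj => ?_
      have hne : i ≠ j := (Finset.ne_of_mem_erase hj).symm
      simp [systemMatrix_boundary α lam d hi, hne]
    rw [this, systemMatrix_boundary α lam d hi]
    simp
  · have hdi : 0 ≤ lam * d i := mul_nonneg hlam (hd i (by omega))
    have hdiag : systemMatrix α lam M d i i = 1 + lam * d i * α := by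
      simp [systemMatrix_interior α lam d hi]
    have hoff : ∑ j ∈ Finset.univ.erase i, |systemMatrix α lam M d i j|
        ≤ lam * d i * ∑ m ∈ (Finset.range ((i + 1) + 1)).erase 1, |grunwaldWeight α m| := by
      have e : ∀ j ∈ Finset.univ.erase i, |systemMatrix α lam M d i j|
          = if (j : ℕ) ≤ i + 1 then lam * d i * |grunwaldWeight α (i + 1 - j)| else 0 := by
        intro j hj
        have hne : i ≠ j := (Finset.ne_of_mem_erase hj).symm
        simp only [systemMatrix_interior α lam d hi, hne, if_false, zero_sub, abs_neg]
        split_ifs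
        · rw [abs_mul, abs_of_nonneg hdi]
        · simp
      rw [Finset.sum_congr rfl e, ← Finset.sum_filter, Finset.mul_sum]
      -- The restriction `j ≤ i + 1` is what makes the truncated subtraction injective.
      have hinj : Set.InjOn (fun j : Fin (M + 1) => (i : ℕ) + 1 - j)
          ((Finset.univ.erase i).filter fun j : Fin (M + 1) => (j : ℕ) ≤ i + 1) := by
        intro a ha b hb hab
        simp only [Finset.coe_filter, Set.mem_ofPred_eq] at ha hb hab
        exact Fin.ext (by omega)
      rw [← Finset.sum_image (f := fun m => lam * d i * |grunwaldWeight α m|) hinj]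
      refine Finset.sum_le_sum_of_subset_of_nonneg ?_ fun _ _ _ => by positivity
      intro m hm
      obtain ⟨j, hj, rfl⟩ := Finset.mem_image.1 hm
      rw [Finset.mem_filter, Finset.mem_erase] at hj
      have hne : (j : ℕ) ≠ i := fun h => hj.1.1 (Fin.ext h)
      rw [Finset.mem_erase, Finset.mem_range]
      omega
    have := mul_le_mul_of_nonneg_left (sum_grunwaldWeight_le hα₁ hα₂ (n := i + 1) (by omega)) hdi
    rw [hdiag]
    linarith

lemma nodeWeight_nonneg {ν v : ℝ} (hν : 0 < ν) (hv : 0 ≤ v) : 0 ≤ nodeWeight ν v :=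
  mul_nonneg hν.le (Real.rpow_nonneg hv _)

lemma spaceStep_pos {L R : ℝ} (hLR : L < R) {M : ℕ} (hM : 0 < M) : 0 < spaceStep L R M :=
  div_pos (sub_pos.2 hLR) (by exact_mod_cast hM)

lemma node_mem_Icc {L R : ℝ} (hLR : L < R) {M j : ℕ} (hM : 0 < M) (hj : j ≤ M) :
    node L R M j ∈ Icc L R := by
  have hh := spaceStep_pos hLR hM
  have hM' : (0 : ℝ) < M := by exact_mod_cast hM
  have hj' : (j : ℝ) ≤ M := by exact_mod_cast hj
  have e : (M : ℝ) * spaceStep L R M = R - L := by rw [spaceStep]; field_simp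
  have h1 : (j : ℝ) * spaceStep L R M ≤ M * spaceStep L R M := by gcongr
  have h2 : 0 ≤ (j : ℝ) * spaceStep L R M := by positivity
  rw [node]
  constructor <;> linarith

/-- The left-hand side of the scheme as a single convolution sum. -/
lemma schemeLHS_eq (α ν lam : ℝ) (V : ℕ → ℝ) (j : ℕ) :
    schemeLHS α ν lam V j = V j ^ ν - lam * nodeWeight ν (V j) *
      ∑ i ∈ Finset.range (j + 2), grunwaldWeight α i * V (j + 1 - i) ^ ν := by
  have h : ∑ i ∈ Finset.range (j + 2), grunwaldWeight α i * V (j + 1 - i) ^ ν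
      = grunwaldWeight α 0 * V (j + 1) ^ ν + grunwaldWeight α 1 * V j ^ ν
        + ∑ i ∈ Finset.Icc 2 (j + 1), grunwaldWeight α i * V (j + 1 - i) ^ ν := by
    rw [Finset.range_eq_Ico, Finset.sum_eq_sum_Ico_succ_bot (by omega),
      Finset.sum_eq_sum_Ico_succ_bot (by omega), ← add_assoc]
    rfl
  rw [h, schemeLHS]
  ring

lemma systemMatrix_mulVec_interior (α lam : ℝ) {M : ℕ} (d g : ℕ → ℝ) {i : Fin (M + 1)}
    (h0 : 0 < (i : ℕ)) (hM : (i : ℕ) < M) :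
    (systemMatrix α lam M d).mulVec (fun j => g j) i
      = g i - lam * d i * ∑ m ∈ Finset.range (i + 2), grunwaldWeight α m * g (i + 1 - m) := by
  have hi : ¬ ((i : ℕ) = 0 ∨ (i : ℕ) = M) := by omega
  have e : (systemMatrix α lam M d).mulVec (fun j => g j) i
      = ∑ j : Fin (M + 1), (if i = j then g j else 0)
        - lam * d i * ∑ j : Fin (M + 1),
          if (j : ℕ) ≤ i + 1 then grunwaldWeight α (i + 1 - j) * g j else 0 := by
    rw [Finset.mul_sum, ← Finset.sum_sub_distrib, Matrix.mulVec, dotProduct]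
    refine Finset.sum_congr rfl fun j _ => ?_
    rw [systemMatrix_interior α lam d hi]
    split_ifs <;> ring
  rw [e, Finset.sum_ite_eq, if_pos (Finset.mem_univ i)]
  congr 2
  rw [Fin.sum_univ_eq_sum_range
    (fun j => if j ≤ (i : ℕ) + 1 then grunwaldWeight α (i + 1 - j) * g j else 0),
    ← Finset.sum_filter]
  have : (Finset.range (M + 1)).filter (fun j => j ≤ (i : ℕ) + 1) = Finset.range (i + 2) := by
    ext j; simp only [Finset.mem_filter, Finset.mem_range]; omega
  rw [this, ← Finset.sum_range_reflect]
  refine Finset.sum_congr rfl fun m hm => ?_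
  have := Finset.mem_range.1 hm
  congr 2
  omega

theorem unconditionallyStable {α ν L R : ℝ} (c : ℝ) (hα₁ : 1 < α) (hα₂ : α ≤ 2) (hν : 0 < ν)
    (hLR : L < R) : UnconditionallyStable α ν c L R := by
  intro M N k hM hk
  have hlam : 0 ≤ meshRatio α c L R M k :=
    div_nonneg (by positivity) (Real.rpow_nonneg (spaceStep_pos hLR hM).le _)
  have hrow : ∀ V : ℕ → ℝ, (∀ j ≤ M, 0 ≤ V j) → ∀ i,
      1 + ∑ j ∈ Finset.univ.erase i, |schemeMatrix α ν c L R M k V i j|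
        ≤ schemeMatrix α ν c L R M k V i i := fun V hV i =>
    sum_systemMatrix_row_le hα₁ hα₂ hlam (fun j hj => nodeWeight_nonneg hν (hV j hj)) i
  refine ⟨fun u₀ B hu₀ v hv => ?_, fun V hV => ?_, fun v hv y z hy hz n hn => ?_⟩
  · have hsys : ∀ n < N, (schemeMatrix α ν c L R M k (v (n + 1))).mulVec (powVec ν M (v (n + 1)))
        = powVec ν M (v n) := by
      intro n hn
      ext i
      by_cases hi : (i : ℕ) = 0 ∨ (i : ℕ) = M
      · have e : (schemeMatrix α ν c L R M k (v (n + 1))).mulVec (powVec ν M (v (n + 1))) i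
            = powVec ν M (v (n + 1)) i := by
          simp [schemeMatrix, systemMatrix_boundary _ _ _ hi, Matrix.mulVec, dotProduct]
        rw [e, powVec, powVec]
        rcases hi with hi | hi
        · rw [hi, hv.left _ hn, hv.left _ hn.le]
        · rw [hi, hv.right _ hn, hv.right _ hn.le]
      · have h0 : 0 < (i : ℕ) := by omega
        have h1 : (i : ℕ) < M := by omega
        have h := systemMatrix_mulVec_interior α (meshRatio α c L R M k)
          (fun j => nodeWeight ν (v (n + 1) j)) (fun j => v (n + 1) j ^ ν) h0 h1
        rw [← schemeLHS_eq, hv.step n hn i h0 h1] at h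
        exact h
    refine ⟨hsys, fun n hn j hj => ?_⟩
    have hB : 0 ≤ B := by
      have := hu₀ L (left_mem_Icc.2 hLR.le)
      linarith
    have hnorm : ∀ n ≤ N, ‖powVec ν M (v n)‖ ≤ B ^ ν := by
      intro n
      induction n with
      | zero =>
        intro _
        rw [pi_norm_le_iff_of_nonneg (Real.rpow_nonneg hB _)]
        intro i
        rw [powVec, Real.norm_of_nonneg (Real.rpow_nonneg (hv.nonneg 0 (Nat.zero_le _) i (by omega)) _)]
        refine Real.rpow_le_rpow (hv.nonneg 0 (Nat.zero_le _) i (by omega)) ?_ hν.le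
        -- The initial function is sampled at interior nodes only; the end values are 0, which is
        -- why `0 ≤ B` is needed.
        rcases Nat.eq_zero_or_pos (i : ℕ) with h0 | h0
        · rw [h0, hv.left 0 (Nat.zero_le _)]; exact hB
        rcases (Nat.lt_succ_iff.1 i.2).eq_or_lt with h1 | h1
        · rw [h1, hv.right 0 (Nat.zero_le _)]; exact hB
        rw [hv.init i h0 h1]
        exact (hu₀ _ (node_mem_Icc hLR hM h1.le)).2
      | succ n ih =>
        intro hn
        have h := norm_le_norm_mulVec _ (hrow (v (n + 1)) (hv.nonneg (n + 1) hn))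
          (powVec ν M (v (n + 1)))
        rw [hsys n hn] at h
        exact h.trans (ih (by omega))
    have h := (norm_le_pi_norm (powVec ν M (v n)) ⟨j, by omega⟩).trans (hnorm n hn)
    rw [powVec, Real.norm_of_nonneg (Real.rpow_nonneg (hv.nonneg n hn j hj) _)] at h
    exact (Real.rpow_le_rpow_iff (hv.nonneg n hn j hj) hB hν).1 h
  · have hA := hrow V hV
    have hdom : StrictlyRowDiagDominant (schemeMatrix α ν c L R M k V) := by
      intro i
      refine lt_of_lt_of_le ?_ (le_abs_self _)
      linarith [hA i]
    have hunit : IsUnit (schemeMatrix α ν c L R M k V) := by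
      rw [Matrix.isUnit_iff_isUnit_det, isUnit_iff_ne_zero]
      exact det_ne_zero_of_sum_row_lt_diag fun i => by simpa using hdom i
    refine ⟨hdom, hunit, fun μ hμ => one_le_re_of_isComplexEigenvalue hA hμ, fun μ hμ => ?_⟩
    obtain ⟨h0, h1⟩ := IsComplexEigenvalue.inv hunit hμ
    have h2 := (one_le_re_of_isComplexEigenvalue hA h1).trans (Complex.re_le_norm _)
    rw [norm_inv] at h2
    exact (one_le_inv₀ (norm_pos_iff.2 h0)).1 h2
  · induction n with
    | zero => exact le_rfl
    | succ n ih =>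
      have h := norm_le_norm_mulVec _ (hrow (v (n + 1)) (hv (n + 1) hn)) (y (n + 1) - z (n + 1))
      rw [Matrix.mulVec_sub, hy n hn, hz n hn] at h
      exact h.trans (ih (by omega))

end Stability

end FracDiff

namespace FracDiff

/-! ### The Riemann–Liouville derivative of a smooth function. -/

section RiemannLiouville

open MeasureTheory intervalIntegral Filter Topology

lemma intervalIntegrable_sub_rpow {γ : ℝ} (hγ : -1 < γ) (L y : ℝ) :
    IntervalIntegrable (fun η => (y - η) ^ γ) volume L y := by
  have h := (intervalIntegrable_rpow' (a := y - L) (b := 0) hγ).comp_sub_left y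
  simpa using h

/-- Integration by parts; the antiderivative of the kernel vanishes at `η = y`, so only the endpoint
`L` contributes. Each use raises the kernel exponent by one. -/
lemma integral_mul_sub_rpow {L R y γ : ℝ} (hγ : -1 < γ) (hy : y ∈ Icc L R) {g g' : ℝ → ℝ}
    (hg : ∀ x ∈ Icc L R, HasDerivWithinAt g (g' x) (Icc L R) x) (hg' : ContinuousOn g' (Icc L R)) :
    ∫ η in L..y, g η * (y - η) ^ γ
      = (g L * (y - L) ^ (γ + 1) + ∫ η in L..y, g' η * (y - η) ^ (γ + 1)) / (γ + 1) := by
  have hγ' : γ + 1 ≠ 0 := by linarith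
  have hsub : Icc L y ⊆ Icc L R := Icc_subset_Icc_right hy.2
  have hu : uIcc L y = Icc L y := uIcc_of_le hy.1
  have hcont : Continuous fun η : ℝ => -((y - η) ^ (γ + 1) / (γ + 1)) := by
    refine (Continuous.div_const ?_ _).neg
    exact (continuous_const.sub continuous_id).rpow_const fun _ => Or.inr (by linarith)
  have h := integral_mul_deriv_eq_deriv_mul_of_hasDerivAt (a := L) (b := y) (u := g) (u' := g')
    (v := fun η => -((y - η) ^ (γ + 1) / (γ + 1))) (v' := fun η => (y - η) ^ γ)
    (by rw [hu]; exact fun x hx => ((hg x (hsub hx)).continuousWithinAt).mono hsub)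
    hcont.continuousOn
    (fun x hx => by
      rw [min_eq_left hy.1, max_eq_right hy.1] at hx
      exact (hg x (hsub (Ioo_subset_Icc_self hx))).hasDerivAt
        (Icc_mem_nhds hx.1 (hx.2.trans_le hy.2)))
    (fun x hx => by
      rw [min_eq_left hy.1, max_eq_right hy.1] at hx
      have h1 : HasDerivAt (fun η : ℝ => y - η) (-1) x := by
        simpa using (hasDerivAt_id x).const_sub y
      have h2 := ((h1.rpow_const (p := γ + 1)
        (Or.inl (sub_pos.2 hx.2).ne')).div_const (γ + 1)).neg
      refine h2.congr_deriv ?_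
      rw [add_sub_cancel_right]
      field_simp)
    ((hg'.mono (by rw [hu]; exact hsub)).intervalIntegrable)
    (intervalIntegrable_sub_rpow hγ L y)
  rw [h]
  simp only [sub_self, Real.zero_rpow hγ', zero_div, neg_zero, mul_zero, mul_neg,
    intervalIntegral.integral_neg]
  simp only [← mul_div_assoc, intervalIntegral.integral_div]
  ring

lemma hasDerivAt_max_rpow {γ : ℝ} (hγ : 1 < γ) (s : ℝ) :
    HasDerivAt (fun s : ℝ => max s 0 ^ γ) (γ * max s 0 ^ (γ - 1)) s := by
  rcases lt_trichotomy s 0 with hs | rfl | hs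
  · rw [max_eq_right hs.le, Real.zero_rpow (by linarith), mul_zero]
    refine (hasDerivAt_const s (0 : ℝ)).congr_of_eventuallyEq ?_
    filter_upwards [Iio_mem_nhds hs] with r hr
    rw [max_eq_right (le_of_lt hr), Real.zero_rpow (by linarith)]
  · rw [max_self, Real.zero_rpow (by linarith), mul_zero]
    have h1 : HasDerivWithinAt (fun s : ℝ => max s 0 ^ γ) 0 (Ici 0) 0 := by
      have := (Real.hasDerivAt_rpow_const (x := 0) (p := γ) (Or.inr hγ.le)).hasDerivWithinAt
        (s := Ici 0)
      rw [Real.zero_rpow (by linarith : γ - 1 ≠ 0), mul_zero] at this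
      exact this.congr (fun r hr => by rw [max_eq_left hr]) (by rw [max_self])
    have h2 : HasDerivWithinAt (fun s : ℝ => max s 0 ^ γ) 0 (Iic 0) 0 :=
      (hasDerivWithinAt_const (0 : ℝ) (Iic 0) (0 : ℝ)).congr
        (fun r hr => by rw [max_eq_right hr, Real.zero_rpow (by linarith)])
        (by rw [max_self, Real.zero_rpow (by linarith)])
    have := h2.union h1
    rwa [Iic_union_Ici, hasDerivWithinAt_univ] at this
  · rw [max_eq_left hs.le]
    refine (Real.hasDerivAt_rpow_const (Or.inl hs.ne')).congr_of_eventuallyEq ?_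
    filter_upwards [Ioi_mem_nhds hs] with r hr
    rw [max_eq_left (le_of_lt hr)]

/-- The truncated power moves the dependence on `y` from the limit of integration into the
integrand, ready for differentiation under the integral sign. -/
lemma integral_mul_sub_rpow_eq_max {L R y γ : ℝ} (hγ : 0 < γ) (hy : y ∈ Icc L R) {G : ℝ → ℝ}
    (hG : ContinuousOn G (Icc L R)) :
    ∫ η in L..y, G η * (y - η) ^ γ = ∫ η in L..R, G η * max (y - η) 0 ^ γ := by
  have hc : ContinuousOn (fun η => G η * max (y - η) 0 ^ γ) (Icc L R) :=
    hG.mul (Continuous.continuousOn (((continuous_const.sub continuous_id).max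
      continuous_const).rpow_const fun _ => Or.inr hγ.le))
  have h1 : IntervalIntegrable (fun η => G η * max (y - η) 0 ^ γ) volume L y :=
    (hc.mono (by rw [uIcc_of_le hy.1]; exact Icc_subset_Icc_right hy.2)).intervalIntegrable
  have h2 : IntervalIntegrable (fun η => G η * max (y - η) 0 ^ γ) volume y R :=
    (hc.mono (by rw [uIcc_of_le hy.2]; exact Icc_subset_Icc_left hy.1)).intervalIntegrable
  rw [← integral_add_adjacent_intervals h1 h2]
  have e2 : ∫ η in y..R, G η * max (y - η) 0 ^ γ = 0 := by
    rw [intervalIntegral.integral_congr (g := fun _ => (0 : ℝ)), intervalIntegral.integral_zero]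
    intro η hη
    rw [uIcc_of_le hy.2] at hη
    simp only
    rw [max_eq_right (sub_nonpos.2 hη.1), Real.zero_rpow hγ.ne', mul_zero]
  rw [e2, add_zero]
  refine intervalIntegral.integral_congr fun η hη => ?_
  rw [uIcc_of_le hy.1] at hη
  rw [max_eq_left (sub_nonneg.2 hη.2)]

lemma hasDerivAt_integral_mul_sub_rpow {L R x γ : ℝ} (hγ : 1 < γ) (hx : x ∈ Ioo L R) {G : ℝ → ℝ}
    (hG : ContinuousOn G (Icc L R)) :
    HasDerivAt (fun y => ∫ η in L..y, G η * (y - η) ^ γ)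
      (γ * ∫ η in L..x, G η * (x - η) ^ (γ - 1)) x := by
  have hLR : L ≤ R := (hx.1.trans hx.2).le
  have hcont : ∀ (p : ℝ), 0 < p → ∀ y, ContinuousOn (fun η => G η * max (y - η) 0 ^ p) (uIcc L R) := by
    intro p hp y
    rw [uIcc_of_le hLR]
    exact hG.mul (Continuous.continuousOn (((continuous_const.sub continuous_id).max
      continuous_const).rpow_const fun _ => Or.inr hp.le))
  obtain ⟨K, hK⟩ := isCompact_Icc.exists_bound_of_continuousOn hG
  have hK0 : 0 ≤ K := (norm_nonneg _).trans (hK L (left_mem_Icc.2 hLR))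
  have h := hasDerivAt_integral_of_dominated_loc_of_deriv_le (μ := volume) (a := L) (b := R)
    (F := fun y η => G η * max (y - η) 0 ^ γ)
    (F' := fun y η => G η * (γ * max (y - η) 0 ^ (γ - 1)))
    (bound := fun _ => K * (γ * (R - L) ^ (γ - 1))) (x₀ := x) (s := Ioo L R)
    (Ioo_mem_nhds hx.1 hx.2)
    (Eventually.of_forall fun y => ((hcont γ (by linarith) y).mono
      uIoc_subset_uIcc).aestronglyMeasurable measurableSet_uIoc)
    (hcont γ (by linarith) x).intervalIntegrable
    (by
      have := ((hcont (γ - 1) (by linarith) x).const_mul γ).mono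
        (uIoc_subset_uIcc (a := L) (b := R))
      refine ContinuousOn.aestronglyMeasurable (this.congr fun η _ => ?_) measurableSet_uIoc
      ring)
    (Eventually.of_forall fun η hη y hy => by
      rw [uIoc_of_le hLR] at hη
      rw [norm_mul, norm_mul, Real.norm_of_nonneg (by linarith : 0 ≤ γ),
        Real.norm_of_nonneg (Real.rpow_nonneg (le_max_right _ _) _)]
      have : max (y - η) 0 ≤ R - L := max_le (by linarith [hη.1, hy.2]) (by linarith)
      have h2 : max (y - η) 0 ^ (γ - 1) ≤ (R - L) ^ (γ - 1) :=
        Real.rpow_le_rpow (le_max_right _ _) this (by linarith)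
      have := hK η (Ioc_subset_Icc_self hη)
      gcongr)
    intervalIntegrable_const
    (Eventually.of_forall fun η hη y hy => by
      have h1 : HasDerivAt (fun y : ℝ => y - η) 1 y := (hasDerivAt_id y).sub_const η
      have h2 := (HasDerivAt.comp y (hasDerivAt_max_rpow hγ (y - η)) h1).const_mul (G η)
      simpa using h2)
  have h2 := h.2
  rw [← intervalIntegral.integral_const_mul]
  have e : ∫ η in L..x, γ * (G η * (x - η) ^ (γ - 1))
      = ∫ η in L..R, G η * (γ * max (x - η) 0 ^ (γ - 1)) := by
    rw [intervalIntegral.integral_const_mul,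
      integral_mul_sub_rpow_eq_max (by linarith) (Ioo_subset_Icc_self hx) hG,
      ← intervalIntegral.integral_const_mul]
    refine intervalIntegral.integral_congr fun η _ => ?_
    ring
  rw [e]
  refine h2.congr_of_eventuallyEq ?_
  filter_upwards [Ioo_mem_nhds hx.1 hx.2] with y hy
  exact integral_mul_sub_rpow_eq_max (by linarith) (Ioo_subset_Icc_self hy) hG

lemma iteratedDeriv_succ_eq_of_hasDerivAt {U : Set ℝ} (hU : IsOpen U) {F F' : ℝ → ℝ}
    (h : ∀ y ∈ U, HasDerivAt F (F' y) y) (n : ℕ) {x : ℝ} (hx : x ∈ U) :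
    iteratedDeriv (n + 1) F x = iteratedDeriv n F' x := by
  rw [iteratedDeriv_succ']
  refine Filter.EventuallyEq.iteratedDeriv_eq n ?_
  filter_upwards [hU.mem_nhds hx] with y hy
  exact (h y hy).deriv

/-- Here `⌊α⌋ + 1 = 3` and the kernel exponent is 0: three derivatives of a plain primitive, with
`Γ(1) = 1` in front. -/
lemma rlDeriv_two {L R : ℝ} {f f1 f2 : ℝ → ℝ}
    (hf : ∀ x ∈ Icc L R, HasDerivWithinAt f (f1 x) (Icc L R) x)
    (hf1 : ∀ x ∈ Icc L R, HasDerivWithinAt f1 (f2 x) (Icc L R) x) {x : ℝ} (hx : x ∈ Ioo L R) :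
    rlDeriv 2 L f x = f2 x := by
  have hin : ∀ {g g' : ℝ → ℝ}, (∀ x ∈ Icc L R, HasDerivWithinAt g (g' x) (Icc L R) x) →
      ∀ y ∈ Ioo L R, HasDerivAt g (g' y) y := fun hg y hy =>
    (hg y (Ioo_subset_Icc_self hy)).hasDerivAt (Icc_mem_nhds hy.1 hy.2)
  have hfl : ⌊(2 : ℝ)⌋₊ = 2 := by norm_num
  have hc : ContinuousOn f (Icc L R) := fun y hy => (hf y hy).continuousWithinAt
  rw [rlDeriv, hfl]
  have e : (fun y => ∫ η in L..y, f η / (y - η) ^ ((2 : ℝ) + 1 - ((2 + 1 : ℕ) : ℝ)))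
      = fun y => ∫ η in L..y, f η := by
    have : (2 : ℝ) + 1 - ((2 + 1 : ℕ) : ℝ) = 0 := by norm_num
    simp only [this, Real.rpow_zero, div_one]
  have h0 : ∀ y ∈ Ioo L R, HasDerivAt (fun y => ∫ η in L..y, f η) (f y) y := fun y hy =>
    intervalIntegral.integral_hasDerivAt_right
      ((hc.mono (by rw [uIcc_of_le hy.1.le]; exact Icc_subset_Icc_right hy.2.le)).intervalIntegrable)
      (hc.stronglyMeasurableAtFilter_nhdsWithin measurableSet_Icc y |>.filter_mono
        (by rw [nhdsWithin_eq_nhds.2 (Icc_mem_nhds hy.1 hy.2)]))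
      (hc.continuousAt (Icc_mem_nhds hy.1 hy.2))
  rw [e, iteratedDeriv_succ_eq_of_hasDerivAt isOpen_Ioo h0 2 hx,
    iteratedDeriv_succ_eq_of_hasDerivAt isOpen_Ioo (hin hf) 1 hx,
    iteratedDeriv_succ_eq_of_hasDerivAt isOpen_Ioo (hin hf1) 0 hx, iteratedDeriv_zero]
  norm_num

/-- The Riemann-Liouville derivative of a `C³` function that vanishes at the base point. -/
lemma Gamma_mul_rlDeriv {α L R : ℝ} (hα₁ : 1 < α) (hα₂ : α < 2) {f f1 f2 f3 : ℝ → ℝ}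
    (hf : ∀ x ∈ Icc L R, HasDerivWithinAt f (f1 x) (Icc L R) x)
    (hf1 : ∀ x ∈ Icc L R, HasDerivWithinAt f1 (f2 x) (Icc L R) x)
    (hf2 : ∀ x ∈ Icc L R, HasDerivWithinAt f2 (f3 x) (Icc L R) x)
    (hf3 : ContinuousOn f3 (Icc L R)) (hfL : f L = 0) {x : ℝ} (hx : x ∈ Ioo L R) :
    Real.Gamma (2 - α) * rlDeriv α L f x
      = f1 L * (x - L) ^ (1 - α) + ∫ η in L..x, f2 η * (x - η) ^ (1 - α) := by
  have hc1 : ContinuousOn f1 (Icc L R) := fun y hy => (hf1 y hy).continuousWithinAt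
  have hc2 : ContinuousOn f2 (Icc L R) := fun y hy => (hf2 y hy).continuousWithinAt
  have hΓ : Real.Gamma (2 - α) ≠ 0 := (Real.Gamma_pos_of_pos (by linarith)).ne'
  have hfl : ⌊α⌋₊ = 1 := by
    rw [Nat.floor_eq_iff (by linarith)]
    norm_num
    exact ⟨hα₁.le, hα₂⟩
  set β := 2 - α with hβ
  -- Three integrations by parts raise the kernel exponent from `β - 1` to `β + 2`, so that both
  -- outer derivatives pass under the integral without meeting a singularity.
  have hβ0 : 0 < β := by linarith
  have hαβ : 1 - α = β - 1 := by rw [hβ]; ring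
  have e : ∀ y ∈ Ioo L R, ∫ η in L..y, f η / (y - η) ^ (α + 1 - ((1 + 1 : ℕ) : ℝ))
      = (f1 L * (y - L) ^ (β + 1) + (f2 L * (y - L) ^ (β + 2)
          + ∫ η in L..y, f3 η * (y - η) ^ (β + 2)) / (β + 2)) / (β + 1) / β := by
    intro y hy
    have hy' := Ioo_subset_Icc_self hy
    have e1 : ∫ η in L..y, f η / (y - η) ^ (α + 1 - ((1 + 1 : ℕ) : ℝ))
        = ∫ η in L..y, f η * (y - η) ^ (β - 1) := by
      refine intervalIntegral.integral_congr fun η hη => ?_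
      rw [uIcc_of_le hy'.1] at hη
      rw [show β - 1 = -(α + 1 - ((1 + 1 : ℕ) : ℝ)) by rw [hβ]; push_cast; ring,
        Real.rpow_neg (sub_nonneg.2 hη.2), div_eq_mul_inv]
    rw [e1, integral_mul_sub_rpow (by linarith) hy' hf hc1, hfL, sub_add_cancel, zero_mul, zero_add,
      integral_mul_sub_rpow (by linarith) hy' hf1 hc2,
      integral_mul_sub_rpow (by linarith) hy' hf2 hf3, show β + 1 + 1 = β + 2 by ring]
  have hpow : ∀ (p : ℝ), ∀ y ∈ Ioo L R,
      HasDerivAt (fun y : ℝ => (y - L) ^ p) (p * (y - L) ^ (p - 1)) y := by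
    intro p y hy
    have h1 : HasDerivAt (fun y : ℝ => y - L) 1 y := (hasDerivAt_id y).sub_const L
    simpa using h1.rpow_const (p := p) (Or.inl (sub_pos.2 hy.1).ne')
  have d1 : ∀ y ∈ Ioo L R, HasDerivAt
      (fun y => ∫ η in L..y, f η / (y - η) ^ (α + 1 - ((1 + 1 : ℕ) : ℝ)))
      ((f1 L * (y - L) ^ β + (f2 L * (y - L) ^ (β + 1)
          + ∫ η in L..y, f3 η * (y - η) ^ (β + 1)) / (β + 1)) / β) y := by
    intro y hy
    have h1 := (((hpow (β + 1) y hy).const_mul (f1 L)).add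
      ((((hpow (β + 2) y hy).const_mul (f2 L)).add
        (hasDerivAt_integral_mul_sub_rpow (by linarith : 1 < β + 2) hy hf3)).div_const
          (β + 2))).div_const (β + 1) |>.div_const β
    refine (h1.congr_of_eventuallyEq ?_).congr_deriv ?_
    · filter_upwards [Ioo_mem_nhds hy.1 hy.2] with z hz
      exact e z hz
    · rw [show β + 2 - 1 = β + 1 by ring, show β + 1 - 1 = β by ring]
      field_simp
  have d2 : ∀ y ∈ Ioo L R, HasDerivAt
      (fun y => (f1 L * (y - L) ^ β + (f2 L * (y - L) ^ (β + 1)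
          + ∫ η in L..y, f3 η * (y - η) ^ (β + 1)) / (β + 1)) / β)
      (f1 L * (y - L) ^ (β - 1) + (f2 L * (y - L) ^ β
          + ∫ η in L..y, f3 η * (y - η) ^ β) / β) y := by
    intro y hy
    have h1 := (((hpow β y hy).const_mul (f1 L)).add
      ((((hpow (β + 1) y hy).const_mul (f2 L)).add
        (hasDerivAt_integral_mul_sub_rpow (by linarith : 1 < β + 1) hy hf3)).div_const
          (β + 1))).div_const β
    refine h1.congr_deriv ?_
    rw [show β + 1 - 1 = β by ring]
    field_simp
  -- One integration by parts applied to the integral of `f2` on the right brings it to the `f3`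
  -- form obtained on the left.
  rw [rlDeriv, hfl, iteratedDeriv_succ_eq_of_hasDerivAt isOpen_Ioo d1 1 hx,
    iteratedDeriv_succ_eq_of_hasDerivAt isOpen_Ioo d2 0 hx, iteratedDeriv_zero, hαβ,
    integral_mul_sub_rpow (by linarith) (Ioo_subset_Icc_self hx) hf2 hf3, sub_add_cancel,
    show ((1 + 1 : ℕ) : ℝ) - α = β by rw [hβ]; push_cast; ring, ← mul_assoc,
    mul_one_div_cancel hΓ, one_mul]

end RiemannLiouville

end FracDiff

namespace FracDiff

/-! ### Taylor estimates, Abel summation and the product-rectangle rule. -/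

section GrunwaldError

open MeasureTheory intervalIntegral

/-- `f1`, `f2`, `f3` are the successive derivatives of `f` on `[L,R]`, and `f3` is continuous. -/
structure IsDerivChain (L R : ℝ) (f f1 f2 f3 : ℝ → ℝ) : Prop where
  deriv₁ : ∀ x ∈ Icc L R, HasDerivWithinAt f (f1 x) (Icc L R) x
  deriv₂ : ∀ x ∈ Icc L R, HasDerivWithinAt f1 (f2 x) (Icc L R) x
  deriv₃ : ∀ x ∈ Icc L R, HasDerivWithinAt f2 (f3 x) (Icc L R) x
  cont : ContinuousOn f3 (Icc L R)

lemma abs_image_sub_le {L R B : ℝ} {g g' : ℝ → ℝ}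
    (hg : ∀ x ∈ Icc L R, HasDerivWithinAt g (g' x) (Icc L R) x) {x y : ℝ} (hx : x ∈ Icc L R)
    (hy : y ∈ Icc L R) (hB : ∀ z ∈ uIcc x y, |g' z| ≤ B) : |g y - g x| ≤ B * |y - x| := by
  have hsub : uIcc x y ⊆ Icc L R := uIcc_subset_Icc hx hy
  exact (convex_uIcc x y).norm_image_sub_le_of_norm_hasDerivWithin_le
    (fun z hz => (hg z (hsub hz)).mono hsub) hB left_mem_uIcc right_mem_uIcc

lemma abs_sub_sub_mul_le {L R K : ℝ} {g g' g'' : ℝ → ℝ}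
    (hg : ∀ x ∈ Icc L R, HasDerivWithinAt g (g' x) (Icc L R) x)
    (hg' : ∀ x ∈ Icc L R, HasDerivWithinAt g' (g'' x) (Icc L R) x)
    (hK : ∀ x ∈ Icc L R, |g'' x| ≤ K) {x y : ℝ} (hx : x ∈ Icc L R) (hy : y ∈ Icc L R) :
    |g y - g x - (y - x) * g' x| ≤ K * |y - x| ^ 2 := by
  have hK0 : 0 ≤ K := (abs_nonneg _).trans (hK x hx)
  have h := abs_image_sub_le (L := L) (R := R) (B := K * |y - x|)
    (g := fun z => g z - (z - x) * g' x) (g' := fun z => g' z - 1 * g' x)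
    (fun z hz => (hg z hz).sub
      (((hasDerivWithinAt_id z _).sub_const x).mul_const (g' x))) hx hy
    (fun z hz => by
      rw [one_mul]
      refine (abs_image_sub_le hg' hx (uIcc_subset_Icc hx hy hz) fun r hr =>
        hK r (uIcc_subset_Icc hx (uIcc_subset_Icc hx hy hz) hr)).trans ?_
      exact mul_le_mul_of_nonneg_left (abs_sub_left_of_mem_uIcc hz) hK0)
  calc _ = |g y - (y - x) * g' x - (g x - (x - x) * g' x)| := by ring_nf
    _ ≤ _ := h
    _ = _ := by ring

namespace IsDerivChain

variable {L R K : ℝ} {f f1 f2 f3 : ℝ → ℝ}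

lemma continuousOn_deriv₂ (hf : IsDerivChain L R f f1 f2 f3) : ContinuousOn f2 (Icc L R) :=
  fun y hy => (hf.deriv₃ y hy).continuousWithinAt

lemma abs_deriv₂_sub_le (hf : IsDerivChain L R f f1 f2 f3) (hK : ∀ x ∈ Icc L R, |f3 x| ≤ K)
    {x y : ℝ} (hx : x ∈ Icc L R) (hy : y ∈ Icc L R) : |f2 y - f2 x| ≤ K * |y - x| :=
  abs_image_sub_le hf.deriv₃ hx hy fun z hz => hK z (uIcc_subset_Icc hx hy hz)

/-- The mean value inequality is applied to the remainder itself, whose derivative is a first-order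
remainder of `f1`; the sharp factor `1/6` is given up. -/
lemma taylor (hf : IsDerivChain L R f f1 f2 f3) (hK : ∀ x ∈ Icc L R, |f3 x| ≤ K)
    {x y : ℝ} (hx : x ∈ Icc L R) (hy : y ∈ Icc L R) :
    |f y - f x - (y - x) * f1 x - (y - x) ^ 2 / 2 * f2 x| ≤ K * |y - x| ^ 3 := by
  have hK0 : 0 ≤ K := (abs_nonneg _).trans (hK x hx)
  have h := abs_image_sub_le (L := L) (R := R) (B := K * |y - x| ^ 2)
    (g := fun z => f z - (z - x) * f1 x - (z - x) ^ 2 / 2 * f2 x)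
    (g' := fun z => f1 z - 1 * f1 x - (2 * (z - x) ^ 1 * 1) / 2 * f2 x)
    (fun z hz => ((hf.deriv₁ z hz).sub
        (((hasDerivWithinAt_id z _).sub_const x).mul_const (f1 x))).sub
        ((((((hasDerivWithinAt_id z _).sub_const x).pow 2).div_const 2).mul_const
          (f2 x)))) hx hy
    (fun z hz => by
      have h1 := abs_sub_sub_mul_le hf.deriv₂ hf.deriv₃ hK hx (uIcc_subset_Icc hx hy hz)
      have h2 := abs_sub_left_of_mem_uIcc hz
      calc _ = |f1 z - f1 x - (z - x) * f2 x| := by ring_nf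
        _ ≤ _ := h1
        _ ≤ _ := by gcongr)
  calc _ = |f y - (y - x) * f1 x - (y - x) ^ 2 / 2 * f2 x
        - (f x - (x - x) * f1 x - (x - x) ^ 2 / 2 * f2 x)| := by ring_nf
    _ ≤ _ := h
    _ = _ := by ring

lemma second_difference (hf : IsDerivChain L R f f1 f2 f3) (hK : ∀ x ∈ Icc L R, |f3 x| ≤ K)
    {x h : ℝ} (hh : 0 < h) (h1 : L ≤ x - h) (h2 : x + h ≤ R) :
    |f (x + h) - 2 * f x + f (x - h) - h ^ 2 * f2 x| ≤ 2 * K * h ^ 3 := by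
  have hx : x ∈ Icc L R := ⟨by linarith, by linarith⟩
  have t1 := hf.taylor hK hx (y := x + h) ⟨by linarith, h2⟩
  have t2 := hf.taylor hK hx (y := x - h) ⟨h1, by linarith⟩
  rw [show x + h - x = h by ring, abs_of_pos hh] at t1
  rw [show x - h - x = -h by ring, abs_neg, abs_of_pos hh] at t2
  have e : f (x + h) - 2 * f x + f (x - h) - h ^ 2 * f2 x
      = (f (x + h) - f x - h * f1 x - h ^ 2 / 2 * f2 x)
        + (f (x - h) - f x - -h * f1 x - (-h) ^ 2 / 2 * f2 x) := by ring
  rw [e]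
  linarith [abs_add_le (f (x + h) - f x - h * f1 x - h ^ 2 / 2 * f2 x)
    (f (x - h) - f x - -h * f1 x - (-h) ^ 2 / 2 * f2 x)]

end IsDerivChain

lemma sum_sub_mul_eq_by_parts (E g : ℕ → ℝ) (n : ℕ) :
    ∑ i ∈ Finset.range n, (E (i + 1) - E i) * g (n - i)
      = ∑ i ∈ Finset.range n, E (i + 1) * (g (n - i) - g (n - i - 1)) + E n * g 0 - E 0 * g n := by
  have h := Finset.sum_range_sub (fun i => E i * g (n - i)) n
  simp only [Nat.sub_self, Nat.sub_zero] at h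
  rw [add_sub_assoc, ← h, ← Finset.sum_add_distrib]
  refine Finset.sum_congr rfl fun i _ => ?_
  rw [← Nat.sub_sub]
  ring

/-- The product-rectangle rule for the fractional integral. -/
lemma abs_integral_sub_sum_le {L h β B : ℝ} (hh : 0 < h) (hβ : 0 < β) {n : ℕ} {g : ℝ → ℝ}
    (hc : ContinuousOn g (Icc L (L + n * h)))
    (hg : ∀ i < n, ∀ η ∈ Icc (L + n * h - (i + 1) * h) (L + n * h - i * h),
      |g η - g (L + n * h - i * h)| ≤ B) :
    |(∫ η in L..(L + n * h), g η * (L + n * h - η) ^ (β - 1))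
      - h ^ β / β * ∑ i ∈ Finset.range n, (((i : ℝ) + 1) ^ β - (i : ℝ) ^ β) * g (L + n * h - i * h)|
      ≤ B * (n * h) ^ β / β := by
  set x := L + n * h with hx
  have hk := intervalIntegrable_sub_rpow (by linarith : -1 < β - 1)
  have hLx : L ≤ x := by rw [hx]; linarith [show 0 ≤ (n : ℝ) * h by positivity]
  have hsub : ∀ i < n, Icc (x - (i + 1) * h) (x - i * h) ⊆ Icc L x := by
    intro i hi
    have : (i : ℝ) + 1 ≤ n := by exact_mod_cast hi
    refine Icc_subset_Icc ?_ (by linarith [show 0 ≤ (i : ℝ) * h by positivity])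
    have := mul_le_mul_of_nonneg_right this hh.le
    rw [hx]; linarith
  have hle : ∀ i : ℕ, x - ((i : ℝ) + 1) * h ≤ x - i * h := fun i => by linarith
  have hint : ∀ i < n, IntervalIntegrable (fun η => g η * (x - η) ^ (β - 1)) volume
      (x - (i + 1) * h) (x - i * h) := fun i hi =>
    ((hk (x - (i + 1) * h) x).mono_set (by
      rw [uIcc_of_le (hle i), uIcc_of_le (by linarith [show 0 ≤ ((i : ℝ) + 1) * h by positivity])]
      exact Icc_subset_Icc_right (by linarith [show 0 ≤ (i : ℝ) * h by positivity]))).continuousOn_mul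
      (hc.mono (by rw [uIcc_of_le (hle i)]; exact hsub i hi))
  -- The kernel is integrated exactly on each cell; only `g` is frozen, at the right endpoint.
  have hkern : ∀ i : ℕ, ∫ η in (x - (i + 1) * h)..(x - i * h), (x - η) ^ (β - 1)
      = h ^ β / β * (((i : ℝ) + 1) ^ β - (i : ℝ) ^ β) := by
    intro i
    rw [intervalIntegral.integral_comp_sub_left (fun s => s ^ (β - 1)) x,
      integral_rpow (Or.inl (by linarith)), sub_add_cancel, sub_sub_cancel, sub_sub_cancel,
      Real.mul_rpow (by positivity) hh.le, Real.mul_rpow (by positivity) hh.le]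
    ring
  have hkint : ∀ i : ℕ, IntervalIntegrable (fun η => (x - η) ^ (β - 1)) volume
      (x - (i + 1) * h) (x - i * h) := fun i =>
    (hk (x - (i + 1) * h) x).mono_set (by
      rw [uIcc_of_le (hle i), uIcc_of_le (by linarith [show 0 ≤ ((i : ℝ) + 1) * h by positivity])]
      exact Icc_subset_Icc_right (by linarith [show 0 ≤ (i : ℝ) * h by positivity]))
  -- Cells are counted backwards from `x`, hence the two reversals of orientation.
  have hsplit : ∫ η in L..x, g η * (x - η) ^ (β - 1)
      = ∑ i ∈ Finset.range n, ∫ η in (x - (i + 1) * h)..(x - i * h), g η * (x - η) ^ (β - 1) := by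
    have h1 := sum_integral_adjacent_intervals (μ := volume) (f := fun η => g η * (x - η) ^ (β - 1))
      (a := fun i : ℕ => x - i * h) (n := n) (fun i hi => by
        have := (hint i hi).symm
        push_cast
        exact this)
    have e : x - n * h = L := by rw [hx]; ring
    rw [e] at h1
    simp only [Nat.cast_zero, zero_mul, sub_zero] at h1
    rw [intervalIntegral.integral_symm, ← h1, ← Finset.sum_neg_distrib]
    refine Finset.sum_congr rfl fun i _ => ?_
    rw [intervalIntegral.integral_symm, neg_neg]
    push_cast
    rfl
  have hloc : ∀ i ∈ Finset.range n,
      |(∫ η in (x - (i + 1) * h)..(x - i * h), g η * (x - η) ^ (β - 1))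
        - h ^ β / β * (((i : ℝ) + 1) ^ β - (i : ℝ) ^ β) * g (x - i * h)|
      ≤ B * (h ^ β / β * (((i : ℝ) + 1) ^ β - (i : ℝ) ^ β)) := by
    intro i hi
    have hi := Finset.mem_range.1 hi
    rw [← hkern i, ← intervalIntegral.integral_mul_const, ← intervalIntegral.integral_sub
      (hint i hi) ((hkint i).mul_const _), ← intervalIntegral.integral_const_mul]
    rw [← Real.norm_eq_abs]
    refine norm_integral_le_of_norm_le (hle i) (ae_of_all _ fun η hη => ?_)
      ((hkint i).const_mul B)
    have hpos : 0 ≤ (x - η) ^ (β - 1) :=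
      Real.rpow_nonneg (by linarith [hη.2, show 0 ≤ (i : ℝ) * h by positivity]) _
    rw [show g η * (x - η) ^ (β - 1) - (x - η) ^ (β - 1) * g (x - i * h)
      = (g η - g (x - i * h)) * (x - η) ^ (β - 1) by ring, norm_mul, Real.norm_of_nonneg hpos]
    exact mul_le_mul_of_nonneg_right (hg i hi η (Ioc_subset_Icc_self hη)) hpos
  rw [hsplit, Finset.mul_sum, ← Finset.sum_sub_distrib]
  have e2 : ∑ i ∈ Finset.range n, B * (h ^ β / β * (((i : ℝ) + 1) ^ β - (i : ℝ) ^ β))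
      = B * (n * h) ^ β / β := by
    have h1 := Finset.sum_range_sub (fun i : ℕ => (i : ℝ) ^ β) n
    push_cast at h1
    rw [← Finset.mul_sum, ← Finset.mul_sum, h1, Real.zero_rpow hβ.ne', sub_zero,
      Real.mul_rpow (by positivity) hh.le]
    ring
  rw [← e2]
  refine (Finset.abs_sum_le_sum_abs _ _).trans (Finset.sum_le_sum fun i hi => ?_)
  rw [← mul_assoc]
  exact hloc i hi

end GrunwaldError

end FracDiff

namespace FracDiff

/-! ### First-order accuracy of the shifted Grünwald formula. -/

section GrunwaldConsistency

variable {α L R K K₁ K₂ h : ℝ} {f f1 f2 f3 : ℝ → ℝ} {n : ℕ}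

/-- The weights of order `α - 2 = 0` vanish beyond index 0, so a single central second difference
remains. -/
lemma IsDerivChain.abs_grunwald_two_sub_le (hf : IsDerivChain L R f f1 f2 f3)
    (hK : ∀ x ∈ Icc L R, |f3 x| ≤ K) (hh : 0 < h) (hn : 1 ≤ n) (hnR : L + (n + 1) * h ≤ R) :
    |(∑ i ∈ Finset.range (n + 2), grunwaldWeight 2 i * f (L + (n + 1 - i : ℕ) * h)) / h ^ (2 : ℝ)
      - rlDeriv 2 L f (L + n * h)| ≤ 2 * K * h := by
  have hn1 : (1 : ℝ) ≤ n := by exact_mod_cast hn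
  have hx0 : h ≤ n * h := by nlinarith
  have hx : L + n * h ∈ Ioo L R := ⟨by linarith, by linarith⟩
  have hw : ∀ i, grunwaldWeight 0 (i + 1) = 0 := fun i => by
    rw [grunwaldWeight, Ring.choose_zero_succ, mul_zero]
  obtain ⟨m, rfl⟩ := Nat.exists_eq_add_of_le' hn
  have hS := sum_grunwaldWeight_mul 2 (m + 1) (fun i => f (L + i * h))
  rw [sub_self, Finset.sum_range_succ' _ m, hw, hw,
    Finset.sum_eq_zero (s := Finset.range m) fun i _ => by rw [hw, zero_mul]] at hS
  simp only [grunwaldWeight_zero, one_mul, zero_mul, add_zero, zero_add, Nat.sub_zero,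
    Nat.add_sub_cancel] at hS
  rw [hS, rlDeriv_two hf.deriv₁ hf.deriv₂ hx, Real.rpow_two]
  have h2 := hf.second_difference hK (x := L + (m + 1 : ℕ) * h) hh (by linarith) (by linarith)
  rw [show L + ((m + 1 : ℕ) : ℝ) * h + h = L + ((m + 1 + 1 : ℕ) : ℝ) * h by push_cast; ring,
    show L + ((m + 1 : ℕ) : ℝ) * h - h = L + (m : ℝ) * h by push_cast; ring] at h2
  have h3 : (0 : ℝ) < h ^ 2 := by positivity
  rw [div_sub' h3.ne', abs_div, abs_of_pos h3, div_le_iff₀ h3]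
  calc _ ≤ _ := h2
    _ = _ := by ring

/-- After two summations by parts the Grünwald sum consists of a discrete fractional integral of
`f''` and a boundary term near `h f'(L)` times a weight. They approximate, respectively, the
integral and the `f'(L)` term of `Gamma_mul_rlDeriv`. -/
lemma IsDerivChain.abs_grunwald_sub_le (hf : IsDerivChain L R f f1 f2 f3) (hfL : f L = 0)
    (hK₁ : |f1 L| ≤ K₁) (hK₂ : |f2 L| ≤ K₂) (hK : ∀ x ∈ Icc L R, |f3 x| ≤ K)
    (hα₁ : 1 < α) (hα₂ : α < 2) (hh : 0 < h) (hn : 1 ≤ n) (hnR : L + (n + 1) * h ≤ R) :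
    |(∑ i ∈ Finset.range (n + 2), grunwaldWeight α i * f (L + (n + 1 - i : ℕ) * h)) / h ^ α
      - rlDeriv α L f (L + n * h)|
      ≤ (7 + 1 / (2 - α)) / Real.Gamma (2 - α + 1) *
        (h * (K₁ * (n * h) ^ (-α) + K₂ * (n * h) ^ (1 - α) + K * (n * h) ^ (2 - α))) := by
  have hn1 : (1 : ℝ) ≤ n := by exact_mod_cast hn
  have hn0 : (0 : ℝ) < n := by linarith
  have hx0 : h ≤ n * h := by nlinarith
  have hxpos : 0 < n * h := by positivity
  have hx : L + n * h ∈ Ioo L R := ⟨by linarith, by linarith⟩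
  have hLmem : L ∈ Icc L R := ⟨le_rfl, (hx.1.trans hx.2).le⟩
  have hK0 : 0 ≤ K := (abs_nonneg _).trans (hK L hLmem)
  have hK₁0 : 0 ≤ K₁ := (abs_nonneg _).trans hK₁
  have hK₂0 : 0 ≤ K₂ := (abs_nonneg _).trans hK₂
  have hmem : ∀ i ≤ n + 1, L + (i : ℝ) * h ∈ Icc L R := by
    intro i hi
    have hi' : (i : ℝ) ≤ n + 1 := by exact_mod_cast hi
    have := mul_le_mul_of_nonneg_right hi' hh.le
    exact ⟨by linarith [show 0 ≤ (i : ℝ) * h by positivity], by linarith⟩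
  obtain ⟨β, rfl⟩ : ∃ β, α = 2 - β := ⟨2 - α, by ring⟩
  have hβ0 : 0 < β := by linarith
  have hβ1 : β < 1 := by linarith
  have hS := sum_grunwaldWeight_mul (2 - β) n (fun i => f (L + i * h))
  have hrl := Gamma_mul_rlDeriv hα₁ hα₂ hf.deriv₁ hf.deriv₂ hf.deriv₃ hf.cont hfL hx
  simp only [show 2 - β - 2 = -β by ring, show 2 - (2 - β) = β by ring,
    show 1 - (2 - β) = β - 1 by ring, show -(2 - β) = β - 2 by ring, add_sub_cancel_left] at hS hrl ⊢
  rw [Nat.cast_zero, zero_mul, add_zero, hfL, mul_zero, mul_zero, sub_zero, add_zero,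
    Nat.cast_one, one_mul] at hS
  set J := ∫ η in L..(L + n * h), f2 η * (L + n * h - η) ^ (β - 1) with hJ
  have hΓ : 0 < Real.Gamma β := Real.Gamma_pos_of_pos hβ0
  have hΓ1 : Real.Gamma (β + 1) = β * Real.Gamma β := Real.Gamma_add_one hβ0.ne'
  set P := 1 / Real.Gamma (β + 1) with hP
  have hP0 : 0 < P := by rw [hP, hΓ1]; positivity
  have hPβ : 1 / Real.Gamma β = β * P := by rw [hP, hΓ1]; field_simp
  have hrl' : rlDeriv (2 - β) L f (L + n * h) = β * P * (f1 L * (n * h) ^ (β - 1) + J) := by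
    rw [← hrl, ← hPβ]; field_simp
  set q := h ^ β with hq
  have hq0 : 0 < q := Real.rpow_pos_of_pos hh β
  set A := ∑ i ∈ Finset.range n, grunwaldWeight (-β) i with hA
  have hAest : |A - (n : ℝ) ^ β * P| ≤ (n : ℝ) ^ (β - 1) * P := by
    have := abs_sum_grunwaldWeight_sub_le hβ0 hβ1 hn
    rwa [div_eq_mul_one_div, div_eq_mul_one_div ((n : ℝ) ^ (β - 1))] at this
  have hAa : grunwaldWeight (-β) n = β * A / n := by
    rw [sum_grunwaldWeight_neg_eq]; field_simp
  have hn_rpow : (n : ℝ) ^ (β - 1) ≤ (n : ℝ) ^ β :=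
    Real.rpow_le_rpow_of_exponent_le hn1 (by linarith)
  have hAle : A ≤ 2 * (n : ℝ) ^ β * P := by
    have h1 := (abs_le.1 hAest).2
    have := mul_le_mul_of_nonneg_right hn_rpow hP0.le
    linarith
  have ha_nonneg : ∀ i, 0 ≤ grunwaldWeight (-β) i := grunwaldWeight_neg_nonneg hβ0.le
  set u := h * (n * h) ^ (β - 2) with hu
  set v := h * (n * h) ^ (β - 1) with hv
  set w := h * (n * h) ^ β with hw
  have hu0 : 0 < u := by rw [hu]; positivity
  have hv0 : 0 < v := by rw [hv]; positivity
  have hw0 : 0 < w := by rw [hw]; positivity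
  have hwq : w = h * q * (n : ℝ) ^ β := by
    rw [hw, hq, Real.mul_rpow hn0.le hh.le]; ring
  have hvq : v = q * (n : ℝ) ^ (β - 1) := by
    rw [hv, hq, Real.mul_rpow hn0.le hh.le, Real.rpow_sub_one hh.ne']; field_simp
  have huq : u * h * n = q * (n : ℝ) ^ (β - 1) := by
    rw [hu, hq, show β - 2 = β - 1 - 1 by ring, Real.mul_rpow hn0.le hh.le,
      Real.rpow_sub_one hh.ne', Real.rpow_sub_one hh.ne', Real.rpow_sub_one hn0.ne' (β - 1)]
    field_simp
  have hvh : v * h ≤ w := by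
    have e : w = v * (n * h) := by
      rw [hw, hv, Real.rpow_sub_one hxpos.ne']; field_simp
    rw [e]; gcongr
  have hhα : h ^ (2 - β) = h ^ 2 / q := by
    rw [Real.rpow_sub hh, Real.rpow_two]
  set D := ∑ i ∈ Finset.range n, grunwaldWeight (-β) i *
    (f (L + (n - i + 1 : ℕ) * h) - 2 * f (L + (n - i : ℕ) * h) + f (L + (n - i - 1 : ℕ) * h)) with hD
  set G := ∑ i ∈ Finset.range n, grunwaldWeight (-β) i * f2 (L + (n - i : ℕ) * h) with hG
  set B := ∑ i ∈ Finset.range n, (((i : ℝ) + 1) ^ β - (i : ℝ) ^ β) * f2 (L + (n - i : ℕ) * h) with hB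
  have bound_diff : |D - h ^ 2 * G| ≤ 2 * K * h ^ 3 * A := by
    rw [hD, hG, Finset.mul_sum, ← Finset.sum_sub_distrib, hA, Finset.mul_sum]
    refine (Finset.abs_sum_le_sum_abs _ _).trans (Finset.sum_le_sum fun i hi => ?_)
    have hi := Finset.mem_range.1 hi
    obtain ⟨m, hm⟩ : ∃ m, n - i = m + 1 := ⟨n - i - 1, by omega⟩
    have h1 := hmem m (by omega)
    have h2 := hmem (m + 2) (by omega)
    push_cast at h2
    have hsd := hf.second_difference hK (x := L + (m + 1 : ℕ) * h) hh
      (by push_cast; linarith [h1.1]) (by push_cast; linarith [h2.2])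
    rw [show L + ((m + 1 : ℕ) : ℝ) * h + h = L + ((m + 1 + 1 : ℕ) : ℝ) * h by push_cast; ring,
      show L + ((m + 1 : ℕ) : ℝ) * h - h = L + (m : ℝ) * h by push_cast; ring] at hsd
    rw [hm, Nat.add_sub_cancel, mul_left_comm, ← mul_sub, abs_mul, abs_of_nonneg (ha_nonneg i),
      mul_comm]
    exact mul_le_mul_of_nonneg_right hsd (ha_nonneg i)
  have bound_first : |f (L + h) - h * f1 L| ≤ h ^ 2 * (K₂ / 2 + K * h) := by
    have ht := hf.taylor hK hLmem (y := L + h) ⟨by linarith, by linarith⟩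
    rw [show L + h - L = h by ring, hfL, sub_zero, abs_of_pos hh] at ht
    have h1 : |h ^ 2 / 2 * f2 L| ≤ h ^ 2 / 2 * K₂ := by
      rw [abs_mul, abs_of_pos (by positivity : 0 < h ^ 2 / 2)]; gcongr
    calc _ = |(f (L + h) - h * f1 L - h ^ 2 / 2 * f2 L) + h ^ 2 / 2 * f2 L| := by ring_nf
      _ ≤ _ := abs_add_le _ _
      _ ≤ K * h ^ 3 + h ^ 2 / 2 * K₂ := add_le_add ht h1
      _ = _ := by ring
  have bound_int : |J - q / β * B| ≤ K * w / β := by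
    have hge : ∀ i : ℕ, i < n → L + (n : ℝ) * h - i * h = L + (n - i : ℕ) * h := fun i hi => by
      rw [Nat.cast_sub hi.le]; ring
    have h1 := abs_integral_sub_sum_le (B := K * h) hh hβ0 (n := n) (g := f2) (L := L)
      (hf.continuousOn_deriv₂.mono (Icc_subset_Icc_right hx.2.le))
      (fun i hi η hη => by
        have hi' : (i : ℝ) + 1 ≤ n := by exact_mod_cast hi
        have hxi : L + (n : ℝ) * h - i * h ∈ Icc L R := by
          rw [hge i hi]; exact hmem _ (by omega)
        have hηm : η ∈ Icc L R := ⟨by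
          have := mul_le_mul_of_nonneg_right hi' hh.le
          linarith [hη.1], hη.2.trans hxi.2⟩
        refine (hf.abs_deriv₂_sub_le hK hxi hηm).trans ?_
        gcongr
        rw [abs_le]
        constructor <;> linarith [hη.1, hη.2])
    have e : ∑ i ∈ Finset.range n, (((i : ℝ) + 1) ^ β - (i : ℝ) ^ β) * f2 (L + n * h - i * h) = B :=
      Finset.sum_congr rfl fun i hi => by rw [hge i (Finset.mem_range.1 hi)]
    rw [e] at h1
    refine h1.trans (le_of_eq ?_)
    rw [hw]; ring
  -- The two sets of weights differ by the increments of `E`, whose values are `O(m^(β-1))`. Abel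
  -- summation puts the difference onto `f2`, gaining a factor `h`; the end term leaves `f2 L`.
  have bound_parts : |G - P * B| ≤ K * h * ((n : ℝ) ^ β / β * P) + (n : ℝ) ^ (β - 1) * P * K₂ := by
    set E : ℕ → ℝ := fun m => ∑ i ∈ Finset.range m, grunwaldWeight (-β) i - (m : ℝ) ^ β * P with hE
    have hE0 : E 0 = 0 := by simp [hE, Real.zero_rpow hβ0.ne']
    have hEb : ∀ m : ℕ, 1 ≤ m → |E m| ≤ (m : ℝ) ^ (β - 1) * P := by
      intro m hm
      have := abs_sum_grunwaldWeight_sub_le hβ0 hβ1 hm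
      rwa [div_eq_mul_one_div, div_eq_mul_one_div ((m : ℝ) ^ (β - 1))] at this
    have h1 : G - P * B = ∑ i ∈ Finset.range n, (E (i + 1) - E i) * f2 (L + (n - i : ℕ) * h) := by
      rw [hG, hB, Finset.mul_sum, ← Finset.sum_sub_distrib]
      refine Finset.sum_congr rfl fun i _ => ?_
      simp only [hE, Finset.sum_range_succ]
      push_cast
      ring
    rw [h1, sum_sub_mul_eq_by_parts E (fun i => f2 (L + i * h)), hE0, zero_mul, sub_zero]
    refine (abs_add_le _ _).trans (add_le_add ?_ ?_)
    · have h2 : ∀ i ∈ Finset.range n,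
          |E (i + 1) * (f2 (L + (n - i : ℕ) * h) - f2 (L + (n - i - 1 : ℕ) * h))|
            ≤ K * h * (((i : ℝ) + 1) ^ (β - 1) * P) := by
        intro i hi
        have hi := Finset.mem_range.1 hi
        have h3 := hEb (i + 1) (by omega)
        have h4 := hf.abs_deriv₂_sub_le hK (hmem (n - i - 1) (by omega)) (hmem (n - i) (by omega))
        have h5 : L + ((n - i : ℕ) : ℝ) * h - (L + ((n - i - 1 : ℕ) : ℝ) * h) = h := by
          rw [Nat.cast_sub (by omega : 1 ≤ n - i)]; push_cast; ring
        rw [h5, abs_of_pos hh] at h4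
        rw [abs_mul, mul_comm]
        push_cast at h3
        exact mul_le_mul h4 h3 (abs_nonneg _) (by positivity)
      refine (Finset.abs_sum_le_sum_abs _ _).trans ((Finset.sum_le_sum h2).trans ?_)
      rw [← Finset.mul_sum, ← Finset.sum_mul]
      have := sum_rpow_sub_one_le hβ0 hβ1.le n
      gcongr
    · rw [abs_mul, Nat.cast_zero, zero_mul, add_zero]
      exact mul_le_mul (hEb n hn) hK₂ (abs_nonneg _) (by positivity)
  -- Five errors: second differences against `h² f2`, Grünwald against product-rectangle weights,
  -- the rectangle rule against the integral, `f (L + h)` against `h f1 L`, and the last weight `β A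
  -- / n` against `β P n^(β-1)`.
  have hdecomp : (∑ i ∈ Finset.range (n + 2),
        grunwaldWeight (2 - β) i * f (L + (n + 1 - i : ℕ) * h)) / h ^ (2 - β)
        - rlDeriv (2 - β) L f (L + n * h)
      = q / h ^ 2 * (D - h ^ 2 * G) + q * (G - P * B) - β * P * (J - q / β * B)
        + q / h ^ 2 * grunwaldWeight (-β) n * (f (L + h) - h * f1 L)
        + β * u * f1 L * ((A - (n : ℝ) ^ β * P) / (n : ℝ) ^ (β - 1)) := by
    rw [hS, hrl', hhα, hAa]
    have e1 : β * u * f1 L * ((A - (n : ℝ) ^ β * P) / (n : ℝ) ^ (β - 1))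
        = β * f1 L * (q / (h * n) * (A - (n : ℝ) ^ β * P)) := by
      have : u = q * (n : ℝ) ^ (β - 1) / (h * n) := by
        rw [← huq]; field_simp
      have hne : (n : ℝ) ^ (β - 1) ≠ 0 := by positivity
      rw [this]; field_simp
    have e2 : (n * h) ^ (β - 1) = q / (h * n) * (n : ℝ) ^ β := by
      rw [Real.mul_rpow hn0.le hh.le, Real.rpow_sub_one hh.ne', Real.rpow_sub_one hn0.ne', ← hq]
      field_simp
    rw [e1, e2]
    field_simp
    ring
  have t1 : |q / h ^ 2 * (D - h ^ 2 * G)| ≤ 4 * P * (K * w) := by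
    rw [abs_mul, abs_of_pos (by positivity : 0 < q / h ^ 2)]
    calc _ ≤ q / h ^ 2 * (2 * K * h ^ 3 * (2 * (n : ℝ) ^ β * P)) := by
          gcongr
          exact bound_diff.trans (by gcongr)
      _ = _ := by rw [hwq]; field_simp; ring
  have t2 : |q * (G - P * B)| ≤ P / β * (K * w) + P * (K₂ * v) := by
    rw [abs_mul, abs_of_pos hq0]
    calc _ ≤ q * (K * h * ((n : ℝ) ^ β / β * P) + (n : ℝ) ^ (β - 1) * P * K₂) := by gcongr
      _ = _ := by rw [hwq, hvq]; field_simp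
  have t3 : |β * P * (J - q / β * B)| ≤ P * (K * w) := by
    rw [abs_mul, abs_of_pos (by positivity : 0 < β * P)]
    calc _ ≤ β * P * (K * w / β) := by gcongr
      _ = _ := by field_simp
  have t4 : |q / h ^ 2 * grunwaldWeight (-β) n * (f (L + h) - h * f1 L)|
      ≤ P * (K₂ * v) + 2 * P * (K * w) := by
    have ha : grunwaldWeight (-β) n ≤ 2 * (n : ℝ) ^ (β - 1) * P := by
      rw [hAa, div_le_iff₀ hn0]
      have e : (n : ℝ) ^ (β - 1) * n = (n : ℝ) ^ β := by
        rw [Real.rpow_sub_one hn0.ne']; field_simp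
      have hApos : 0 ≤ A := Finset.sum_nonneg fun i _ => ha_nonneg i
      calc β * A ≤ 1 * A := by gcongr
        _ ≤ 2 * (n : ℝ) ^ β * P := by rw [one_mul]; exact hAle
        _ = _ := by rw [← e]; ring
    rw [abs_mul, abs_mul, abs_of_pos (by positivity : 0 < q / h ^ 2), abs_of_nonneg (ha_nonneg n)]
    calc _ ≤ q / h ^ 2 * (2 * (n : ℝ) ^ (β - 1) * P) * (h ^ 2 * (K₂ / 2 + K * h)) := by
          gcongr
      _ = P * (K₂ * v) + 2 * P * (K * (v * h)) := by rw [hvq]; field_simp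
      _ ≤ _ := by gcongr
  have t5 : |β * u * f1 L * ((A - (n : ℝ) ^ β * P) / (n : ℝ) ^ (β - 1))| ≤ P * (K₁ * u) := by
    have hpos : (0 : ℝ) < (n : ℝ) ^ (β - 1) := by positivity
    have h1 : |(A - (n : ℝ) ^ β * P) / (n : ℝ) ^ (β - 1)| ≤ P := by
      rw [abs_div, abs_of_pos hpos, div_le_iff₀ hpos, mul_comm P]
      exact hAest
    rw [abs_mul, abs_mul, abs_of_pos (by positivity : 0 < β * u)]
    calc _ ≤ 1 * u * K₁ * P := by gcongr
      _ = _ := by ring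
  -- The coefficient of `K w` is the largest: `4 + 1/β` from `t1` and `t2`, `1` from `t3`, `2` from
  -- `t4`, all times `P`. This is the constant `7 + 1/β`.
  have hPβ0 : 0 < P / β := by positivity
  rw [hdecomp, div_eq_mul_one_div (7 + 1 / β), ← hP]
  have e : (7 + 1 / β) * P * (h * (K₁ * (n * h) ^ (β - 2) + K₂ * (n * h) ^ (β - 1) + K * (n * h) ^ β))
      = (7 * P + P / β) * (K₁ * u + K₂ * v + K * w) := by
    rw [hu, hv, hw]; ring
  rw [e]
  have s1 := abs_add_le (q / h ^ 2 * (D - h ^ 2 * G) + q * (G - P * B) - β * P * (J - q / β * B)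
        + q / h ^ 2 * grunwaldWeight (-β) n * (f (L + h) - h * f1 L))
    (β * u * f1 L * ((A - (n : ℝ) ^ β * P) / (n : ℝ) ^ (β - 1)))
  have s2 := abs_add_le (q / h ^ 2 * (D - h ^ 2 * G) + q * (G - P * B) - β * P * (J - q / β * B))
    (q / h ^ 2 * grunwaldWeight (-β) n * (f (L + h) - h * f1 L))
  have s3 := abs_sub (q / h ^ 2 * (D - h ^ 2 * G) + q * (G - P * B)) (β * P * (J - q / β * B))
  have s4 := abs_add_le (q / h ^ 2 * (D - h ^ 2 * G)) (q * (G - P * B))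
  have p1 : 0 ≤ P * (K₁ * u) := by positivity
  have p2 : 0 ≤ P * (K₂ * v) := by positivity
  have p3 : 0 ≤ P * (K * w) := by positivity
  have p4 : 0 ≤ P / β * (K₁ * u) := by positivity
  have p5 : 0 ≤ P / β * (K₂ * v) := by positivity
  linarith

/-- The shifted Grünwald formula is first order accurate, uniformly up to the base point for
functions whose first two derivatives vanish there. -/
theorem exists_grunwald_error_bound (hα₁ : 1 < α) (hα₂ : α ≤ 2) :
    ∃ C : ℝ, 0 ≤ C ∧ ∀ (L R K K₁ K₂ h : ℝ) (f f1 f2 f3 : ℝ → ℝ) (n : ℕ),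
      IsDerivChain L R f f1 f2 f3 → f L = 0 → |f1 L| ≤ K₁ → |f2 L| ≤ K₂ →
      (∀ x ∈ Icc L R, |f3 x| ≤ K) → 0 < h → 1 ≤ n → L + (n + 1) * h ≤ R →
      |(∑ i ∈ Finset.range (n + 2), grunwaldWeight α i * f (L + (n + 1 - i : ℕ) * h)) / h ^ α
        - rlDeriv α L f (L + n * h)|
        ≤ C * (h * (K₁ * (n * h) ^ (-α) + K₂ * (n * h) ^ (1 - α) + K * (n * h) ^ (2 - α))) := by
  rcases hα₂.eq_or_lt with rfl | hα₂
  · refine ⟨2, by norm_num, fun L R K K₁ K₂ h f f1 f2 f3 n hf hfL hK₁ hK₂ hK hh hn hnR => ?_⟩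
    refine (hf.abs_grunwald_two_sub_le hK hh hn hnR).trans ?_
    have hK₁0 : 0 ≤ K₁ := (abs_nonneg _).trans hK₁
    have hK₂0 : 0 ≤ K₂ := (abs_nonneg _).trans hK₂
    have h1 : 0 ≤ K₁ * ((n : ℝ) * h) ^ (-2 : ℝ) := by positivity
    have h2 : 0 ≤ K₂ * ((n : ℝ) * h) ^ (1 - 2 : ℝ) := by positivity
    rw [sub_self, Real.rpow_zero, mul_one, mul_assoc, mul_comm K h]
    have := mul_le_mul_of_nonneg_left (by linarith :
      K ≤ K₁ * ((n : ℝ) * h) ^ (-2 : ℝ) + K₂ * ((n : ℝ) * h) ^ (1 - 2 : ℝ) + K) hh.le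
    linarith
  · refine ⟨(7 + 1 / (2 - α)) / Real.Gamma (2 - α + 1), ?_,
      fun L R K K₁ K₂ h f f1 f2 f3 n hf hfL hK₁ hK₂ hK hh hn hnR =>
        hf.abs_grunwald_sub_le hfL hK₁ hK₂ hK hα₁ hα₂ hh hn hnR⟩
    have h1 : 0 < 2 - α := by linarith
    have := Real.Gamma_pos_of_pos (by linarith : 0 < 2 - α + 1)
    positivity

end GrunwaldConsistency

end FracDiff

namespace FracDiff

/-! ### Truncation error of the scheme. -/

section Consistency

lemma exists_partialDeriv_fst {I J : Set ℝ} (hI : UniqueDiffOn ℝ I) (hJ : UniqueDiffOn ℝ J) {n : ℕ}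
    {F : ℝ × ℝ → ℝ} (hF : ContDiffOn ℝ (n + 1) F (I ×ˢ J)) :
    ∃ G : ℝ × ℝ → ℝ, ContDiffOn ℝ n G (I ×ˢ J) ∧
      ∀ x ∈ I, ∀ t ∈ J, HasDerivWithinAt (fun x => F (x, t)) (G (x, t)) I x := by
  refine ⟨fun p => fderivWithin ℝ F (I ×ˢ J) p (1, 0),
    (hF.fderivWithin (hI.prod hJ) le_rfl).clm_apply contDiffOn_const, fun x hx t ht => ?_⟩
  have h := (hF.differentiableOn (by simp) (x, t) ⟨hx, ht⟩).hasFDerivWithinAt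
  have hm : MapsTo (fun y => (y, t)) I (I ×ˢ J) := fun y hy => ⟨hy, ht⟩
  exact h.comp_hasDerivWithinAt x
    ((hasDerivWithinAt_id x I).prodMk (hasDerivWithinAt_const x I t)) hm

lemma exists_partialDeriv_snd {I J : Set ℝ} (hI : UniqueDiffOn ℝ I) (hJ : UniqueDiffOn ℝ J) {n : ℕ}
    {F : ℝ × ℝ → ℝ} (hF : ContDiffOn ℝ (n + 1) F (I ×ˢ J)) :
    ∃ G : ℝ × ℝ → ℝ, ContDiffOn ℝ n G (I ×ˢ J) ∧
      ∀ x ∈ I, ∀ t ∈ J, HasDerivWithinAt (fun t => F (x, t)) (G (x, t)) J t := by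
  refine ⟨fun p => fderivWithin ℝ F (I ×ˢ J) p (0, 1),
    (hF.fderivWithin (hI.prod hJ) le_rfl).clm_apply contDiffOn_const, fun x hx t ht => ?_⟩
  have h := (hF.differentiableOn (by simp) (x, t) ⟨hx, ht⟩).hasFDerivWithinAt
  have hm : MapsTo (fun y => (x, y)) J (I ×ˢ J) := fun y hy => ⟨hx, hy⟩
  exact h.comp_hasDerivWithinAt t
    ((hasDerivWithinAt_const t J x).prodMk (hasDerivWithinAt_id t J)) hm

/-- The iterated partial derivatives in the first variable of a `C³` function. -/
lemma exists_partialDeriv_chain {I J : Set ℝ} (hI : UniqueDiffOn ℝ I) (hJ : UniqueDiffOn ℝ J)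
    {F : ℝ × ℝ → ℝ} (hF : ContDiffOn ℝ 3 F (I ×ˢ J)) :
    ∃ F1 F2 F3 : ℝ × ℝ → ℝ, ContinuousOn F1 (I ×ˢ J) ∧ ContinuousOn F2 (I ×ˢ J) ∧
      ContinuousOn F3 (I ×ˢ J) ∧ ∀ x ∈ I, ∀ t ∈ J,
        HasDerivWithinAt (fun x => F (x, t)) (F1 (x, t)) I x ∧
        HasDerivWithinAt (fun x => F1 (x, t)) (F2 (x, t)) I x ∧
        HasDerivWithinAt (fun x => F2 (x, t)) (F3 (x, t)) I x := by
  obtain ⟨F1, h1, d1⟩ := exists_partialDeriv_fst hI hJ (n := 2) (by exact_mod_cast hF)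
  obtain ⟨F2, h2, d2⟩ := exists_partialDeriv_fst hI hJ (n := 1) (by exact_mod_cast h1)
  obtain ⟨F3, h3, d3⟩ := exists_partialDeriv_fst hI hJ (n := 0) (by exact_mod_cast h2)
  exact ⟨F1, F2, F3, h1.continuousOn, h2.continuousOn, h3.continuousOn,
    fun x hx t ht => ⟨d1 x hx t ht, d2 x hx t ht, d3 x hx t ht⟩⟩

/-- Even at `x = L` the derivative is determined from the left, where `g` vanishes. Iterated, it
yields vanishing first and second space derivatives at `L` for the zero extension. -/
lemma HasDerivWithinAt.eq_zero_of_eqOn_zero {L R x a : ℝ} (hLR : L ≤ R) (hx : x ∈ Iic L)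
    {g : ℝ → ℝ} (hg : ∀ y ∈ Iic L, g y = 0) (h : HasDerivWithinAt g a (Iic R) x) : a = 0 :=
  (uniqueDiffOn_Iic L x hx).eq_deriv _ (h.mono (Iic_subset_Iic.2 hLR))
    ((hasDerivWithinAt_const x (Iic L) (0 : ℝ)).congr hg (hg x hx))

lemma exists_abs_le_of_continuousOn_prod {L R T : ℝ} {G : ℝ × ℝ → ℝ}
    (hG : ContinuousOn G (Icc L R ×ˢ Icc 0 T)) :
    ∃ K : ℝ, 0 ≤ K ∧ ∀ x ∈ Icc L R, ∀ t ∈ Icc 0 T, |G (x, t)| ≤ K := by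
  obtain ⟨K, hK⟩ := (isCompact_Icc.prod isCompact_Icc).exists_bound_of_continuousOn hG
  exact ⟨max K 0, le_max_right _ _, fun x hx t ht => (hK (x, t) ⟨hx, ht⟩).trans (le_max_left _ _)⟩

/-- The error of the backward difference quotient in time. -/
lemma exists_backward_difference_bound {ν L R T : ℝ} (hLR : L < R) (hT : 0 < T) {u : ℝ → ℝ → ℝ}
    (hu : IsTestProfile ν L R T u) :
    ∃ K : ℝ, 0 ≤ K ∧ ∀ x ∈ Icc L R, ∀ s ∈ Icc 0 T, ∀ t ∈ Icc 0 T, s < t →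
      |(u x t ^ ν - u x s ^ ν) / (t - s) - derivWithin (fun s => u x s ^ ν) (Icc 0 T) t|
        ≤ K * (t - s) := by
  have hI := uniqueDiffOn_Icc hLR
  have hJ := uniqueDiffOn_Icc hT
  obtain ⟨G, h1, d1⟩ := exists_partialDeriv_snd hI hJ (n := 2) (by exact_mod_cast hu.smooth)
  obtain ⟨H, h2, d2⟩ := exists_partialDeriv_snd hI hJ (n := 1) (by exact_mod_cast h1)
  obtain ⟨K, hK0, hK⟩ := exists_abs_le_of_continuousOn_prod h2.continuousOn
  refine ⟨K, hK0, fun x hx s hs t ht hst => ?_⟩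
  have h := abs_sub_sub_mul_le (d1 x hx) (d2 x hx) (hK x hx) ht hs
  have hpos : 0 < t - s := sub_pos.2 hst
  rw [(d1 x hx t ht).derivWithin (hJ t ht), div_sub' hpos.ne', abs_div, abs_of_pos hpos,
    div_le_iff₀ hpos]
  rw [abs_sub_comm s t, abs_of_pos hpos] at h
  calc _ = |u x s ^ ν - u x t ^ ν - (s - t) * G (x, t)| := by
        rw [← abs_neg]; ring_nf
    _ ≤ _ := h
    _ = _ := by ring

lemma node_lt {L R : ℝ} (hLR : L < R) {M j : ℕ} (hM : 0 < M) (hj : j < M) :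
    L + ((j : ℝ) + 1) * spaceStep L R M ≤ R := by
  have := (node_mem_Icc hLR hM (j := j + 1) hj).2
  rw [node] at this
  exact_mod_cast this

/-- The local truncation error splits into the error of the time difference and the error of the
Grünwald formula. -/
lemma truncationError_eq (α ν c L R T : ℝ) (u : ℝ → ℝ → ℝ) (M : ℕ) {k : ℝ} (hk : 0 < k)
    (j n : ℕ) :
    truncationError α ν c L R T u M k j n
      = ((u (node L R M j) ((n + 1 : ℕ) * k) ^ ν - u (node L R M j) (n * k) ^ ν)
            / ((n + 1 : ℕ) * k - n * k)
          - derivWithin (fun s => u (node L R M j) s ^ ν) (Icc 0 T) ((n + 1 : ℕ) * k))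
        - nodeWeight ν (u (node L R M j) ((n + 1 : ℕ) * k)) * c ^ 2 *
          ((∑ i ∈ Finset.range (j + 2), grunwaldWeight α i *
              u (L + (j + 1 - i : ℕ) * spaceStep L R M) ((n + 1 : ℕ) * k) ^ ν)
              / spaceStep L R M ^ α
            - rlDeriv α L (fun y => u y ((n + 1 : ℕ) * k) ^ ν) (L + j * spaceStep L R M)) := by
  have e : ((n + 1 : ℕ) : ℝ) * k - n * k = k := by push_cast; ring
  rw [truncationError, schemeResidual, pdeResidual, schemeLHS_eq, meshRatio, e]
  simp only [node]
  field_simp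
  ring

theorem consistentFirstOrder {α ν L R : ℝ} (c : ℝ) (hα₁ : 1 < α) (hα₂ : α ≤ 2) (hν : 0 < ν)
    (hLR : L < R) : ConsistentFirstOrder α ν c L R := by
  intro T hT u hu
  obtain ⟨C, hC0, hC⟩ := exists_grunwald_error_bound hα₁ hα₂
  obtain ⟨Kt, hKt0, hKt⟩ := exists_backward_difference_bound hLR hT hu
  have hI := uniqueDiffOn_Icc hLR
  have hJ := uniqueDiffOn_Icc hT
  have huL : ∀ t ∈ Icc 0 T, u L t ^ ν = 0 := fun t ht => by
    rw [hu.left t ht, Real.zero_rpow hν.ne']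
  -- Common to both claims, which differ only in the derivative chain supplied and in the bounds at
  -- `L`.
  have key : ∀ (F1 F2 F3 : ℝ × ℝ → ℝ) (K K₁ K₂ : ℝ),
      (∀ t ∈ Icc 0 T, IsDerivChain L R (fun x => u x t ^ ν) (fun x => F1 (x, t))
        (fun x => F2 (x, t)) (fun x => F3 (x, t))) →
      (∀ t ∈ Icc 0 T, |F1 (L, t)| ≤ K₁) → (∀ t ∈ Icc 0 T, |F2 (L, t)| ≤ K₂) →
      (∀ x ∈ Icc L R, ∀ t ∈ Icc 0 T, |F3 (x, t)| ≤ K) →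
      ∀ (M : ℕ) (k : ℝ), 0 < M → 0 < k → ∀ j n : ℕ, 0 < j → j < M →
        ((n + 1 : ℕ) : ℝ) * k ≤ T →
        |truncationError α ν c L R T u M k j n| ≤ Kt * k
          + nodeWeight ν (u (node L R M j) ((n + 1 : ℕ) * k)) * c ^ 2 * (C * (spaceStep L R M *
            (K₁ * (node L R M j - L) ^ (-α) + K₂ * (node L R M j - L) ^ (1 - α)
              + K * (node L R M j - L) ^ (2 - α)))) := by
    intro F1 F2 F3 K K₁ K₂ hchain hK₁ hK₂ hK M k hM hk j n hj hjM htT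
    have hs : (n : ℝ) * k ∈ Icc 0 T := ⟨by positivity, by push_cast at htT; linarith⟩
    have ht : ((n + 1 : ℕ) : ℝ) * k ∈ Icc 0 T := ⟨by positivity, htT⟩
    have hst : (n : ℝ) * k < ((n + 1 : ℕ) : ℝ) * k := by push_cast; linarith
    have hnode := node_mem_Icc hLR hM hjM.le
    have h1 := hKt _ hnode _ hs _ ht hst
    have h2 := hC L R K K₁ K₂ (spaceStep L R M) _ _ _ _ j (hchain _ ht) (huL _ ht) (hK₁ _ ht)
      (hK₂ _ ht) (fun x hx => hK x hx _ ht) (spaceStep_pos hLR hM) hj (node_lt hLR hM hjM)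
    have hw : 0 ≤ nodeWeight ν (u (node L R M j) ((n + 1 : ℕ) * k)) * c ^ 2 :=
      mul_nonneg (nodeWeight_nonneg hν (hu.nonneg _ hnode _ ht)) (sq_nonneg c)
    have e : node L R M j - L = j * spaceStep L R M := by rw [node]; ring
    rw [truncationError_eq α ν c L R T u M hk, e]
    refine (abs_sub _ _).trans (add_le_add ?_ ?_)
    · refine h1.trans (le_of_eq ?_)
      push_cast; ring
    · rw [abs_mul, abs_of_nonneg hw]
      exact mul_le_mul_of_nonneg_left h2 hw
  constructor
  · intro S hS hSsub
    obtain ⟨F1, F2, F3, c1, c2, c3, hd⟩ := exists_partialDeriv_chain hI hJ hu.smooth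
    obtain ⟨K₁, -, hK₁⟩ := exists_abs_le_of_continuousOn_prod c1
    obtain ⟨K₂, -, hK₂⟩ := exists_abs_le_of_continuousOn_prod c2
    obtain ⟨K, -, hK⟩ := exists_abs_le_of_continuousOn_prod c3
    have hLmem : L ∈ Icc L R := left_mem_Icc.2 hLR.le
    have hsub : S ⊆ Icc L R ×ˢ Icc 0 T := fun p hp =>
      ⟨Ioo_subset_Icc_self (hSsub hp).1, Ioc_subset_Icc_self (hSsub hp).2⟩
    have hpow : ∀ q : ℝ, ContinuousOn (fun p : ℝ × ℝ => (p.1 - L) ^ q) S := fun q =>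
      (continuousOn_fst.sub continuousOn_const).rpow_const fun p hp =>
        Or.inl (sub_pos.2 (hSsub hp).1.1).ne'
    have hweight : ContinuousOn (fun p : ℝ × ℝ => nodeWeight ν (u p.1 p.2)) S := by
      -- Only `u^ν` is known to be regular, so `u^(ν-1)` is written as a power of it. The exponent
      -- is negative when `ν < 1`, where positivity of `u` enters.
      have h1 : ContinuousOn (fun p : ℝ × ℝ => ν * (u p.1 p.2 ^ ν) ^ ((ν - 1) / ν)) S := by
        refine continuousOn_const.mul ((hu.smooth.continuousOn.mono hsub).rpow_const fun p hp => ?_)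
        rcases lt_or_ge ν 1 with h | h
        · exact Or.inl (Real.rpow_pos_of_pos (hu.pos h _ (hSsub hp).1 _ (hSsub hp).2) _).ne'
        · exact Or.inr (div_nonneg (by linarith) hν.le)
      refine h1.congr fun p hp => ?_
      simp only
      rw [nodeWeight, ← Real.rpow_mul (hu.nonneg _ (hsub hp).1 _ (hsub hp).2)]
      congr 2
      field_simp
    have hcont : ContinuousOn (fun p : ℝ × ℝ => nodeWeight ν (u p.1 p.2) * c ^ 2 *
        (C * (K₁ * (p.1 - L) ^ (-α) + K₂ * (p.1 - L) ^ (1 - α) + K * (p.1 - L) ^ (2 - α)))) S :=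
      (hweight.mul continuousOn_const).mul (continuousOn_const.mul
        (((continuousOn_const.mul (hpow _)).add (continuousOn_const.mul (hpow _))).add
          (continuousOn_const.mul (hpow _))))
    obtain ⟨B, hB⟩ := hS.exists_bound_of_continuousOn hcont
    refine ⟨Kt + |B|, fun M k hM hk j n hj hjM hmem => ?_⟩
    have h1 := key F1 F2 F3 K K₁ K₂
      (fun t ht => ⟨fun x hx => (hd x hx t ht).1, fun x hx => (hd x hx t ht).2.1,
        fun x hx => (hd x hx t ht).2.2,
        c3.comp (Continuous.prodMk_left t).continuousOn fun x hx => ⟨hx, ht⟩⟩)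
      (hK₁ L hLmem) (hK₂ L hLmem) hK M k hM hk j n hj hjM (hSsub hmem).2.2
    have h2 := ((le_abs_self _).trans (hB _ hmem)).trans (le_abs_self B)
    have hh := spaceStep_pos hLR hM
    have h3 := mul_le_mul_of_nonneg_right h2 hh.le
    have h4 : 0 ≤ Kt * spaceStep L R M := by positivity
    have h5 : 0 ≤ |B| * k := by positivity
    refine h1.trans ?_
    simp only at h3
    linarith
  · intro hext
    obtain ⟨F1, F2, F3, c1, c2, c3, hd⟩ := exists_partialDeriv_chain (uniqueDiffOn_Iic R) hJ hext
    have hsub : Icc L R ⊆ Iic R := Icc_subset_Iic_self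
    have hprod : Icc L R ×ˢ Icc 0 T ⊆ Iic R ×ˢ Icc 0 T := prod_mono_left hsub
    have hIic : ∀ x ∈ Iic L, x ∈ Iic R := fun x hx => le_trans hx hLR.le
    have z0 : ∀ t ∈ Icc 0 T, ∀ x ∈ Iic L, (if L ≤ x then u x t ^ ν else 0) = 0 := by
      intro t ht x hx
      split_ifs with h
      · rw [le_antisymm hx h, huL t ht]
      · rfl
    have z1 : ∀ t ∈ Icc 0 T, ∀ x ∈ Iic L, F1 (x, t) = 0 := fun t ht x hx =>
      HasDerivWithinAt.eq_zero_of_eqOn_zero hLR.le hx (z0 t ht) (hd x (hIic x hx) t ht).1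
    have z2 : ∀ t ∈ Icc 0 T, ∀ x ∈ Iic L, F2 (x, t) = 0 := fun t ht x hx =>
      HasDerivWithinAt.eq_zero_of_eqOn_zero hLR.le hx (z1 t ht) (hd x (hIic x hx) t ht).2.1
    obtain ⟨K, hK0, hK⟩ := exists_abs_le_of_continuousOn_prod (c3.mono hprod)
    have hP0 : 0 ≤ c ^ 2 * (C * (K * (R - L) ^ (2 - α))) := by
      have : 0 ≤ (R - L) ^ (2 - α) := Real.rpow_nonneg (sub_pos.2 hLR).le _
      positivity
    refine ⟨Kt + c ^ 2 * (C * (K * (R - L) ^ (2 - α))), fun M k hM hk j n hj hjM htT => ?_⟩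
    -- With `K₁ = K₂ = 0` the singular powers drop out, and `(x - L)^(2-α)` is bounded by `(R -
    -- L)^(2-α)` since `2 - α ≥ 0`.
    have h1 := key F1 F2 F3 K 0 0
      (fun t ht => ⟨fun x hx => (((hd x (hsub hx) t ht).1.mono hsub).congr
          (fun y hy => (if_pos hy.1).symm) (if_pos hx.1).symm),
        fun x hx => (hd x (hsub hx) t ht).2.1.mono hsub,
        fun x hx => (hd x (hsub hx) t ht).2.2.mono hsub,
        (c3.mono hprod).comp (Continuous.prodMk_left t).continuousOn fun x hx => ⟨hx, ht⟩⟩)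
      (fun t ht => by rw [z1 t ht L self_mem_Iic, abs_zero])
      (fun t ht => by rw [z2 t ht L self_mem_Iic, abs_zero]) hK M k hM hk j n hj hjM htT
    have hh := spaceStep_pos hLR hM
    have hnode := node_mem_Icc hLR hM hjM.le
    have hw := nodeWeight_nonneg hν
      (hu.nonneg _ hnode _ (⟨by positivity, htT⟩ : ((n + 1 : ℕ) : ℝ) * k ∈ Icc 0 T))
    set δ := nodeWeight ν (u (node L R M j) ((n + 1 : ℕ) * k))
    have h2 : (node L R M j - L) ^ (2 - α) ≤ (R - L) ^ (2 - α) :=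
      Real.rpow_le_rpow (sub_nonneg.2 hnode.1) (by linarith [hnode.2]) (by linarith)
    refine h1.trans ?_
    rw [zero_mul, zero_mul, add_zero, zero_add]
    have h3 : δ * c ^ 2 * (C * (spaceStep L R M * (K * (node L R M j - L) ^ (2 - α))))
        ≤ δ * c ^ 2 * (C * (spaceStep L R M * (K * (R - L) ^ (2 - α)))) := by gcongr
    have h4 : 0 ≤ Kt * (δ * spaceStep L R M) := by positivity
    have h5 := mul_nonneg hP0 hk.le
    linarith

end Consistency

end FracDiff

theorem theorem2 (α ν c L R : ℝ) (hα₁ : 1 < α) (hα₂ : α ≤ 2) (hν : 0 < ν) (hLR : L < R) :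
    FracDiff.ConsistentFirstOrder α ν c L R ∧ FracDiff.UnconditionallyStable α ν c L R :=
  ⟨FracDiff.consistentFirstOrder c hα₁ hα₂ hν hLR, FracDiff.unconditionallyStable c hα₁ hα₂ hν hLR⟩
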